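/- Let $f:\{0,1\}^*\to\{0,1\}$ be a function in $\mathsf{P}$, and let $d:\mathbb{N}\to\mathbb{N}$ satisfy $d(n)=o(n)$. Suppose that for every $n$ the restriction $f_n:\mathbb{F}_2^n\to\mathbb{F}_2$ of $f$ to inputs of length $n$ is an affine disperser of dimension $d(n)$, that is, $f_n$ is not constant on any affine subspace of $\mathbb{F}_2^n$ of dimension at least $d(n)$. Circuits are over the basis of all Boolean functions of fan-in at most $2$, and the size of a circuit is the number of its binary gates. Then there is a function $s(n)=3n-o(n)$ and a $\mathsf{P}^{\mathsf{NP}}$-constructive separation of $f$ from circuits of size $s(n)$: there is a deterministic polynomial-time algorithm $R$ with an $\mathsf{NP}$ oracle such that, for all but finitely many $n$, given $1^n$ and any circuit $C$ with $n$ inputs and size strictly less than $s(n)$, $R$ prints a string $x\in\{0,1\}^n$ with $C(x)\neq f(x)$. -/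

import Mathlib

open Filter Asymptotics

/-! ### Oracle programs with a step count

The machine model: a finite program works on finitely many stacks of bits and may query an oracle.
A multi-tape Turing machine is the same thing up to a constant factor in time (a tape is a pair of
stacks, the control flow of the program is the finite control); every elementary action costs one
step. -/

/-- Programs acting on stacks of bits, which are addressed by natural numbers.  A program mentions
only finitely many stacks. -/
inductive OracleProg : Type
  /-- do nothing -/
  | skip : OracleProg
  /-- push the bit `b` on stack `r` -/
  | push (r : ℕ) (b : Bool) : OracleProg
  /-- run one program after the other -/
  | seq (c₁ c₂ : OracleProg) : OracleProg
  /-- if stack `r` is empty, run `cEmpty`; otherwise remove its top bit and run `cFalse` or `cTrue`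
  according to that bit -/
  | pop (r : ℕ) (cEmpty cFalse cTrue : OracleProg) : OracleProg
  /-- as long as stack `r` is not empty, run `c` -/
  | loop (r : ℕ) (c : OracleProg) : OracleProg
  /-- ask the oracle about the string on stack `r`, run `cYes` or `cNo` according to the answer -/
  | query (r : ℕ) (cYes cNo : OracleProg) : OracleProg

/-- The contents of the stacks, the top of a stack being the head of the list. -/
abbrev Store : Type := ℕ → List Bool

/-- `OracleProg.Runs A c σ t τ`: with oracle `A`, the program `c` started on `σ` halts after exactly
`t` steps, and leaves `τ`. -/
inductive OracleProg.Runs (A : Language Bool) : OracleProg → Store → ℕ → Store → Prop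
  | skip (σ : Store) : Runs A .skip σ 1 σ
  | push (r : ℕ) (b : Bool) (σ : Store) :
      Runs A (.push r b) σ 1 (Function.update σ r (b :: σ r))
  | seq {c₁ c₂ : OracleProg} {σ σ' σ'' : Store} {t₁ t₂ : ℕ} :
      Runs A c₁ σ t₁ σ' → Runs A c₂ σ' t₂ σ'' → Runs A (.seq c₁ c₂) σ (t₁ + t₂) σ''
  | popEmpty {r : ℕ} {cE cF cT : OracleProg} {σ σ' : Store} {t : ℕ} :
      σ r = [] → Runs A cE σ t σ' → Runs A (.pop r cE cF cT) σ (t + 1) σ'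
  | popFalse {r : ℕ} {cE cF cT : OracleProg} {σ σ' : Store} {t : ℕ} {l : List Bool} :
      σ r = false :: l → Runs A cF (Function.update σ r l) t σ' →
        Runs A (.pop r cE cF cT) σ (t + 1) σ'
  | popTrue {r : ℕ} {cE cF cT : OracleProg} {σ σ' : Store} {t : ℕ} {l : List Bool} :
      σ r = true :: l → Runs A cT (Function.update σ r l) t σ' →
        Runs A (.pop r cE cF cT) σ (t + 1) σ'
  | loopDone {r : ℕ} {c : OracleProg} {σ : Store} :
      σ r = [] → Runs A (.loop r c) σ 1 σ
  | loopStep {r : ℕ} {c : OracleProg} {σ σ' σ'' : Store} {t t' : ℕ} :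
      σ r ≠ [] → Runs A c σ t σ' → Runs A (.loop r c) σ' t' σ'' →
        Runs A (.loop r c) σ (t + t' + 1) σ''
  | queryYes {r : ℕ} {cY cN : OracleProg} {σ σ' : Store} {t : ℕ} :
      σ r ∈ A → Runs A cY σ t σ' → Runs A (.query r cY cN) σ (t + 1) σ'
  | queryNo {r : ℕ} {cY cN : OracleProg} {σ σ' : Store} {t : ℕ} :
      σ r ∉ A → Runs A cN σ t σ' → Runs A (.query r cY cN) σ (t + 1) σ'

/-- The initial store: the input is on stack `0`, all other stacks are empty. -/
def initStore (w : List Bool) : Store := Function.update (fun _ => []) 0 w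

/-- `F` is computed, with oracle `A`, by a program that halts on every input `w` within a number of
steps polynomial in the length of `w`, with the output on stack `0`. -/
def PolyTimeWithOracle (A : Language Bool) (F : List Bool → List Bool) : Prop :=
  ∃ (c : OracleProg) (p : Polynomial ℕ), ∀ w : List Bool,
    ∃ (t : ℕ) (τ : Store), t ≤ p.eval w.length ∧ c.Runs A (initStore w) t τ ∧ τ 0 = F w

/-! ### The classes `P`, `NP`, and the search class `P^NP` -/

/-- `f ∈ P`: polynomial time with the empty oracle, that is, without help from an oracle. -/
def InP (f : List Bool → Bool) : Prop :=
  PolyTimeWithOracle (∅ : Set (List Bool)) (fun w => [f w])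

/-- Encoding of a pair of bit strings by one bit string: every bit of `w` is announced by `true`,
the end of `w` by `false`, and then `u` follows. -/
def pairBits (w u : List Bool) : List Bool :=
  w.flatMap (fun b => [true, b]) ++ false :: u

/-- `L ∈ NP`: membership has certificates of polynomial length that are verified in `P`. -/
def InNP (L : Language Bool) : Prop :=
  ∃ (V : List Bool → Bool) (q : Polynomial ℕ), InP V ∧
    ∀ w : List Bool, w ∈ L ↔ ∃ u : List Bool, u.length ≤ q.eval w.length ∧ V (pairBits w u) = true

/-- Functions computed by `P^NP` algorithms: deterministic polynomial time with an `NP` oracle. -/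
def PNPAlgorithms : Set (List Bool → List Bool) :=
  {R | ∃ A : Language Bool, InNP A ∧ PolyTimeWithOracle A R}

/-! ### Circuits over the basis of all Boolean functions of fan-in at most two -/

/-- A gate computes a Boolean function of fan-in at most two of earlier wires. -/
inductive B2Gate : Type
  | const (b : Bool) : B2Gate
  | unary (op : Bool → Bool) (i : ℕ) : B2Gate
  | binary (op : Bool → Bool → Bool) (i j : ℕ) : B2Gate

/-- The gate reads only wires with number less than `m`. -/
def B2Gate.ReadsBelow (m : ℕ) : B2Gate → Prop
  | .const _ => True
  | .unary _ i => i < m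
  | .binary _ i j => i < m ∧ j < m

/-- The value of the gate, given the list of the values of the earlier wires. -/
def B2Gate.eval (vals : List Bool) : B2Gate → Bool
  | .const b => b
  | .unary op i => op (vals.getD i false)
  | .binary op i j => op (vals.getD i false) (vals.getD j false)

/-- Is the gate a binary gate? -/
def B2Gate.isBinary : B2Gate → Bool
  | .binary _ _ _ => true
  | _ => false

/-- A circuit on `n` inputs with its gates in topological order: wires `0, …, n - 1` are the inputs,
wire `n + k` is the output of gate number `k`, and gate number `k` reads wires below `n + k`. -/
structure B2Circuit (n : ℕ) : Type where
  gates : List B2Gate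
  out : ℕ
  gates_ok : ∀ (k : ℕ) (hk : k < gates.length), (gates[k]).ReadsBelow (n + k)
  out_ok : out < n + gates.length

/-- The values of all wires on input `x`. -/
def B2Circuit.wires {n : ℕ} (C : B2Circuit n) (x : Fin n → Bool) : List Bool :=
  C.gates.foldl (fun vals g => vals ++ [g.eval vals]) (List.ofFn x)

/-- The Boolean function computed by the circuit. -/
def B2Circuit.eval {n : ℕ} (C : B2Circuit n) (x : Fin n → Bool) : Bool :=
  (C.wires x).getD C.out false

/-- The size of a circuit is the number of its binary gates. -/
def B2Circuit.size {n : ℕ} (C : B2Circuit n) : ℕ :=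
  C.gates.countP B2Gate.isBinary

/-- A natural number in unary, with an end mark. -/
def unaryBits (k : ℕ) : List Bool := List.replicate k true ++ [false]

/-- A gate as a bit string: its kind, its truth table, and the numbers of the wires it reads. -/
def B2Gate.encode : B2Gate → List Bool
  | .const b => [false, false, b]
  | .unary op i => [false, true, op false, op true] ++ unaryBits i
  | .binary op i j =>
      [true, op false false, op false true, op true false, op true true] ++
        unaryBits i ++ unaryBits j

/-- The input `(1^n, C)` as a bit string: `n` in unary, the list of the gates (each announced by
`true`, the end of the list by `false`), and the number of the output wire.  Wire numbers are less
than `n` plus the number of gates, so writing them in unary costs only a polynomial factor. -/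
def B2Circuit.encode {n : ℕ} (C : B2Circuit n) : List Bool :=
  unaryBits n ++ C.gates.flatMap (fun g => true :: g.encode) ++ false :: unaryBits C.out

/-! ### Refuters and constructive separations -/

/-- `R` is a refuter for `f` against circuits of size less than `s n`: for almost every `n`, given
`1^n` and such a circuit on `n` inputs, `R` prints an `n`-bit string on which the circuit differs
from `f`. -/
def IsRefuter (R : List Bool → List Bool) (f : List Bool → Bool) (s : ℕ → ℝ) : Prop :=
  ∀ᶠ n : ℕ in atTop, ∀ C : B2Circuit n, (C.size : ℝ) < s n →
    ∃ x : Fin n → Bool, R C.encode = List.ofFn x ∧ C.eval x ≠ f (List.ofFn x)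

/-- There is a constructive separation of `f` from circuits of size `s n` whose refuter belongs to
the class `Γ` of algorithms. -/
def HasConstructiveSeparation (Γ : Set (List Bool → List Bool)) (f : List Bool → Bool)
    (s : ℕ → ℝ) : Prop :=
  ∃ R ∈ Γ, IsRefuter R f s

/-! ### Affine dispersers -/

/-- The restriction of `f` to inputs of length `n`, as a function on `𝔽₂ⁿ`. -/
def sliceF2 (f : List Bool → Bool) (n : ℕ) (x : Fin n → ZMod 2) : Bool :=
  f (List.ofFn fun i => decide (x i = 1))

/-- `g` is not constant on any affine subspace of `𝔽₂ⁿ` of dimension at least `d`. -/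
def IsAffineDisperser {n : ℕ} (d : ℕ) (g : (Fin n → ZMod 2) → Bool) : Prop :=
  ∀ S : AffineSubspace (ZMod 2) (Fin n → ZMod 2), (S : Set (Fin n → ZMod 2)).Nonempty →
    d ≤ Module.finrank (ZMod 2) S.direction → ∃ x ∈ S, ∃ y ∈ S, g x ≠ g y

/-! Two facts combine: small circuits err somewhere, by gate elimination, and an error of a circuit
can be found by a search with an `NP` oracle. For the first, let m count the inputs and binary gates
of a circuit. The function it computes is constant on some coset of codimension at most m / 4 + 1
(`ComputesOn.constOnSubcoset`); since m is at most n + size, a disperser of dimension d has no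
circuit with size + 4d + 4 < 3n (`IsAffineDisperser.exists_ne`). The induction works on a coset,
where every node that happens to be affine counts as an input, however it was computed. After
redundant nodes are dropped, let Q be the first non-affine node, with arguments a and b. These are
affine and Q is not their exclusive or, so a suitable value of either argument makes Q constant, and
fixing that value is one linear equation. If a also feeds another non-affine gate P, fix a: then a,
Q, P and a reader of Q disappear, or, when that reader is P, a reader of P
(`ComputesOn.eliminate_double`). If a feeds only Q, fix b: then b, Q, a reader of Q and the now
useless a disappear (`ComputesOn.eliminate_single`). Each dimension lost pays for four nodes, unless
the output has already become constant. For the second, f is in `P`, so it is an `NP` question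
whether a prefix extends to an n-bit string on which the circuit differs from f (`InP.exists_inNP`).
Asking it repeatedly fixes the bits of such a string one by one (`exec_search`,
`InP.exists_refuter`). The programs are analysed twice: `Exec` follows their effect on meaningful
stores without counting steps, while `GrowsBy` and `PolyBounded` bound their time on arbitrary
stores without saying what they compute. Determinism, `Runs.final_unique`, joins the two. -/

/-! ### A lower bound for affine dispersers -/

section LowerBound

variable {n : ℕ}

/-- Vectors over the field with two elements. -/
abbrev F2Vec (n : ℕ) : Type := Fin n → ZMod 2

/-- The coset `x₀ + W`, as a set. -/
def coset (x₀ : F2Vec n) (W : Submodule (ZMod 2) (F2Vec n)) : Set (F2Vec n) := {x | x - x₀ ∈ W}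

/-- The function agrees on the set `A` with an affine function. -/
def AffineOn (A : Set (F2Vec n)) (g : F2Vec n → Bool) : Prop :=
  ∃ (φ : F2Vec n →ₗ[ZMod 2] ZMod 2) (c : Bool), ∀ x ∈ A, g x = xor (decide (φ x = 1)) c

lemma AffineOn.mono {A B : Set (F2Vec n)} {g : F2Vec n → Bool} (h : AffineOn A g) (hBA : B ⊆ A) :
    AffineOn B g := by
  obtain ⟨φ, c, hφ⟩ := h
  exact ⟨φ, c, fun x hx => hφ x (hBA hx)⟩

lemma AffineOn.of_const {A : Set (F2Vec n)} {g : F2Vec n → Bool} (c : Bool)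
    (h : ∀ x ∈ A, g x = c) : AffineOn A g :=
  ⟨0, c, fun x hx => by simp [h x hx]⟩

/-- Exclusive or is addition over the field with two elements. This is why the first non-affine gate
of a circuit cannot be of this type. -/
lemma AffineOn.xor {A : Set (F2Vec n)} {g g₁ g₂ : F2Vec n → Bool} (h₁ : AffineOn A g₁)
    (h₂ : AffineOn A g₂) (c : Bool) (h : ∀ x ∈ A, g x = xor (xor (g₁ x) (g₂ x)) c) :
    AffineOn A g := by
  obtain ⟨φ, c₁, h₁⟩ := h₁
  obtain ⟨ψ, c₂, h₂⟩ := h₂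
  refine ⟨φ + ψ, Bool.xor (Bool.xor c₁ c₂) c, fun x hx => ?_⟩
  rw [h x hx, h₁ x hx, h₂ x hx, LinearMap.add_apply]
  have key : ∀ (a b : ZMod 2) (c₁ c₂ c : Bool),
      Bool.xor (Bool.xor (Bool.xor (decide (a = 1)) c₁) (Bool.xor (decide (b = 1)) c₂)) c =
        Bool.xor (decide (a + b = 1)) (Bool.xor (Bool.xor c₁ c₂) c) := by decide
  exact key _ _ _ _ _

/-- Intersecting with the kernel of the linear part costs at most one dimension; the new base point
decides which value the function is frozen at. -/
lemma AffineOn.exists_coset {x₀ : F2Vec n} {W : Submodule (ZMod 2) (F2Vec n)}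
    {g : F2Vec n → Bool} (h : AffineOn (coset x₀ W) g) {x₁ : F2Vec n} (hx₁ : x₁ ∈ coset x₀ W) :
    ∃ W' : Submodule (ZMod 2) (F2Vec n),
      Module.finrank (ZMod 2) W ≤ Module.finrank (ZMod 2) W' + 1 ∧
      coset x₁ W' ⊆ coset x₀ W ∧ ∀ x ∈ coset x₁ W', g x = g x₁ := by
  obtain ⟨φ, c, hφ⟩ := h
  have hsub : coset x₁ (W ⊓ LinearMap.ker φ) ⊆ coset x₀ W := fun x hx => by
    have h1 : x - x₁ ∈ W := hx.1
    have h2 : x₁ - x₀ ∈ W := hx₁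
    have : x - x₀ = (x - x₁) + (x₁ - x₀) := by abel
    change x - x₀ ∈ W
    rw [this]
    exact W.add_mem h1 h2
  refine ⟨W ⊓ LinearMap.ker φ, ?_, hsub, fun x hx => ?_⟩
  · have h1 := Submodule.finrank_sup_add_finrank_inf_eq W (LinearMap.ker φ)
    have h2 := LinearMap.finrank_range_add_finrank_ker φ
    have h3 := Submodule.finrank_le (W ⊔ LinearMap.ker φ)
    have h4 := Submodule.finrank_le (LinearMap.range φ)
    rw [Module.finrank_self] at h4
    omega
  · have h1 : φ (x - x₁) = 0 := hx.2
    rw [map_sub, sub_eq_zero] at h1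
    rw [hφ x (hsub hx), hφ x₁ hx₁, h1]

/-! ### Circuits on a subset of the space, and the removal of nodes -/

variable (val : ℕ → F2Vec n → Bool)

/-- On `A`, the function `g` is a function of the node `z`. -/
def FactorsOn (A : Set (F2Vec n)) (g : F2Vec n → Bool) (z : ℕ) : Prop :=
  ∃ h : Bool → Bool, ∀ x ∈ A, g x = h (val z x)

/-- `N` is the set of nodes of a circuit that computes `F` on `A`; node `0` is an additional
constant.  Nodes that are affine on `A` count as inputs. -/
structure ComputesOn (A : Set (F2Vec n)) (N : Finset ℕ) (l r : ℕ → ℕ) (F : F2Vec n → Bool)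
    (o : ℕ) : Prop where
  pos : 0 ∉ N
  left : ∀ v ∈ N, ¬ AffineOn A (val v) → l v < v ∧ l v ∈ insert 0 N
  right : ∀ v ∈ N, ¬ AffineOn A (val v) → r v < v ∧ r v ∈ insert 0 N
  gate : ∀ v ∈ N, ¬ AffineOn A (val v) →
    ∃ op : Bool → Bool → Bool, ∀ x ∈ A, val v x = op (val (l v) x) (val (r v) x)
  out_mem : o ∈ insert 0 N
  out : FactorsOn val A F o

variable {val}

lemma FactorsOn.trans {A : Set (F2Vec n)} {g : F2Vec n → Bool} {z z' : ℕ}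
    (h : FactorsOn val A g z) (h' : FactorsOn val A (val z) z') : FactorsOn val A g z' := by
  obtain ⟨k, hk⟩ := h
  obtain ⟨k', hk'⟩ := h'
  exact ⟨k ∘ k', fun x hx => by simp [hk x hx, hk' x hx]⟩

lemma FactorsOn.of_const {A : Set (F2Vec n)} {g : F2Vec n → Bool} {z : ℕ} (c : Bool)
    (h : ∀ x ∈ A, g x = c) : FactorsOn val A g z := ⟨fun _ => c, h⟩

lemma FactorsOn.refl {A : Set (F2Vec n)} {z : ℕ} : FactorsOn val A (val z) z :=
  ⟨id, fun _ _ => rfl⟩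

lemma FactorsOn.mono {A B : Set (F2Vec n)} {g : F2Vec n → Bool} {z : ℕ}
    (h : FactorsOn val A g z) (hBA : B ⊆ A) : FactorsOn val B g z := by
  obtain ⟨k, hk⟩ := h
  exact ⟨k, fun x hx => hk x (hBA hx)⟩

/-- Nodes in `S` that are functions of earlier nodes and nodes in `U` that are not needed can be
removed from a circuit. -/
lemma ComputesOn.remove {A B : Set (F2Vec n)} {N : Finset ℕ} {l r : ℕ → ℕ}
    {F : F2Vec n → Bool} {o : ℕ} (hC : ComputesOn val A N l r F o) (hBA : B ⊆ A)
    (S U : Finset ℕ)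
    (hS : ∀ p ∈ S, ∃ z < p, z ∈ insert 0 N ∧ z ∉ U ∧ FactorsOn val B (val p) z)
    (hUl : ∀ w ∈ N, w ∉ S → w ∉ U → ¬ AffineOn A (val w) → l w ∉ U ∧ r w ∉ U)
    (hUo : o ∉ U) :
    ∃ (l' r' : ℕ → ℕ) (o' : ℕ), ComputesOn val B (N \ (S ∪ U)) l' r' F o' := by
  -- The node that replaces a removed node may itself be removed, so replacements are followed
  -- downwards until a surviving node is reached. The numbers decrease, and node `0` always survives
  -- when it is not in `U`.
  have key : ∀ p, p ∈ insert 0 N → p ∉ U →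
      ∃ p' ≤ p, p' ∈ insert 0 (N \ (S ∪ U)) ∧ FactorsOn val B (val p) p' := by
    intro p
    induction p using Nat.strong_induction_on with
    | _ p ih =>
      intro hp hpU
      by_cases hpS : p ∈ S
      · obtain ⟨z, hzp, hz, hzU, hfac⟩ := hS p hpS
        obtain ⟨p', hp', hmem, hfac'⟩ := ih z hzp hz hzU
        exact ⟨p', by omega, hmem, hfac.trans hfac'⟩
      · refine ⟨p, le_rfl, ?_, FactorsOn.refl⟩
        rcases Finset.mem_insert.1 hp with rfl | hp
        · simp
        · simp [hp, hpS, hpU]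
  choose! ρ hρ using key
  have hnaff : ∀ v, ¬ AffineOn B (val v) → ¬ AffineOn A (val v) := fun v h h' => h (h'.mono hBA)
  have hsplit : ∀ v ∈ N \ (S ∪ U), v ∈ N ∧ v ∉ S ∧ v ∉ U := fun v hv => by
    simpa [not_or] using hv
  refine ⟨ρ ∘ l, ρ ∘ r, ρ o, ?_, ?_, ?_, ?_, (hρ o hC.out_mem hUo).2.1,
    (hC.out.mono hBA).trans (hρ o hC.out_mem hUo).2.2⟩
  · exact fun h => hC.pos (hsplit 0 h).1
  · intro v hv haff
    obtain ⟨hvN, hvS, hvU⟩ := hsplit v hv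
    have h1 := hC.left v hvN (hnaff v haff)
    have h2 := hρ (l v) h1.2 (hUl v hvN hvS hvU (hnaff v haff)).1
    exact ⟨lt_of_le_of_lt h2.1 h1.1, h2.2.1⟩
  · intro v hv haff
    obtain ⟨hvN, hvS, hvU⟩ := hsplit v hv
    have h1 := hC.right v hvN (hnaff v haff)
    have h2 := hρ (r v) h1.2 (hUl v hvN hvS hvU (hnaff v haff)).2
    exact ⟨lt_of_le_of_lt h2.1 h1.1, h2.2.1⟩
  · intro v hv haff
    obtain ⟨hvN, hvS, hvU⟩ := hsplit v hv
    obtain ⟨op, hop⟩ := hC.gate v hvN (hnaff v haff)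
    have hU := hUl v hvN hvS hvU (hnaff v haff)
    obtain ⟨k₁, hk₁⟩ := (hρ (l v) (hC.left v hvN (hnaff v haff)).2 hU.1).2.2
    obtain ⟨k₂, hk₂⟩ := (hρ (r v) (hC.right v hvN (hnaff v haff)).2 hU.2).2.2
    exact ⟨fun a b => op (k₁ a) (k₂ b), fun x hx => by
      simp [hop x (hBA hx), hk₁ x hx, hk₂ x hx]⟩

/-- If one of the two arguments of a gate is constant, the gate is a function of the other. -/
lemma FactorsOn.of_gate {A B : Set (F2Vec n)} (hBA : B ⊆ A) {g : F2Vec n → Bool} {a b : ℕ}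
    (h : ∃ op : Bool → Bool → Bool, ∀ x ∈ A, g x = op (val a x) (val b x)) (c : Bool)
    (ha : ∀ x ∈ B, val a x = c) : FactorsOn val B g b := by
  obtain ⟨op, hop⟩ := h
  exact ⟨op c, fun x hx => by rw [hop x (hBA hx), ha x hx]⟩

lemma exists_swap_gate {A : Set (F2Vec n)} {g : F2Vec n → Bool} {a b : ℕ}
    (h : ∃ op : Bool → Bool → Bool, ∀ x ∈ A, g x = op (val a x) (val b x)) :
    ∃ op : Bool → Bool → Bool, ∀ x ∈ A, g x = op (val b x) (val a x) := by
  obtain ⟨op, hop⟩ := h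
  exact ⟨fun p q => op q p, hop⟩

/-- A Boolean operation in two variables depends on at most one of them, or is an exclusive or, or
can be made constant by fixing either of its arguments. -/
lemma bool_op_cases (op : Bool → Bool → Bool) :
    (∃ h : Bool → Bool, ∀ a b, op a b = h a) ∨ (∃ h : Bool → Bool, ∀ a b, op a b = h b) ∨
    (∃ c, ∀ a b, op a b = xor (xor a b) c) ∨
    ((∃ α c, ∀ b, op α b = c) ∧ ∃ β c, ∀ a, op a β = c) := by
  revert op
  decide

/-- A node that reads `q` and is not affine is, where `q` is constant, a function of an earlier
node. -/
lemma ComputesOn.factors_of_reads {A B : Set (F2Vec n)} {N : Finset ℕ} {l r : ℕ → ℕ}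
    {F : F2Vec n → Bool} {o : ℕ} (hC : ComputesOn val A N l r F o) (hBA : B ⊆ A) {q T : ℕ}
    (hT : T ∈ N) (hTA : ¬ AffineOn A (val T)) (hq : l T = q ∨ r T = q) (c : Bool)
    (hc : ∀ x ∈ B, val q x = c) :
    ∃ z < T, z ∈ insert 0 N ∧ (z = l T ∨ z = r T) ∧ FactorsOn val B (val T) z := by
  rcases hq with rfl | rfl
  · exact ⟨r T, (hC.right T hT hTA).1, (hC.right T hT hTA).2, Or.inr rfl,
      FactorsOn.of_gate hBA (hC.gate T hT hTA) c hc⟩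
  · exact ⟨l T, (hC.left T hT hTA).1, (hC.left T hT hTA).2, Or.inl rfl,
      FactorsOn.of_gate hBA (exists_swap_gate (hC.gate T hT hTA)) c hc⟩

/-- The conclusion of the elimination argument: `F` is constant on a coset whose dimension
is smaller than that of `W` by at most `k`. -/
def ConstOnSubcoset (W : Submodule (ZMod 2) (F2Vec n)) (F : F2Vec n → Bool)
    (k : ℕ) : Prop :=
  ∃ (x₁ : F2Vec n) (W' : Submodule (ZMod 2) (F2Vec n)),
    Module.finrank (ZMod 2) W ≤ Module.finrank (ZMod 2) W' + k ∧
    ∃ c, ∀ x ∈ coset x₁ W', F x = c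

lemma ConstOnSubcoset.mono {W : Submodule (ZMod 2) (F2Vec n)}
    {F : F2Vec n → Bool} {k k' : ℕ} (h : ConstOnSubcoset W F k) (hk : k ≤ k') :
    ConstOnSubcoset W F k' := by
  obtain ⟨x₁, W', h1, h2⟩ := h
  exact ⟨x₁, W', by omega, h2⟩

lemma self_mem_coset (x₀ : F2Vec n) (W : Submodule (ZMod 2) (F2Vec n)) : x₀ ∈ coset x₀ W := by
  simp [coset]

lemma card_sdiff_four {N S : Finset ℕ} {a b c d : ℕ} (hS : S = {a, b, c, d}) (hab : a ≠ b)
    (hac : a ≠ c) (had : a ≠ d) (hbc : b ≠ c) (hbd : b ≠ d) (hcd : c ≠ d) (ha : a ∈ N)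
    (hb : b ∈ N) (hc : c ∈ N) (hd : d ∈ N) : (N \ S).card + 4 = N.card := by
  have h4 : S.card = 4 := by
    subst hS
    rw [Finset.card_insert_of_notMem (by simp [*]), Finset.card_insert_of_notMem (by simp [*]),
      Finset.card_insert_of_notMem (by simp [*]), Finset.card_singleton]
  have hsub : S ⊆ N := by
    subst hS
    intro p hp
    simp only [Finset.mem_insert, Finset.mem_singleton] at hp
    rcases hp with rfl | rfl | rfl | rfl <;> assumption
  have := Finset.card_sdiff_add_card_eq_card hsub
  omega

/-! ### One round of gate elimination -/

section Step

variable {x₀ : F2Vec n} {W : Submodule (ZMod 2) (F2Vec n)} {N : Finset ℕ} {l r : ℕ → ℕ}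
  {F : F2Vec n → Bool} {o : ℕ}

/-- The induction hypothesis of the elimination argument. -/
def EliminatesBelow (val : ℕ → F2Vec n → Bool) (F : F2Vec n → Bool) (m : ℕ) : Prop :=
  ∀ (x₀ : F2Vec n) (W : Submodule (ZMod 2) (F2Vec n)) (N : Finset ℕ) (l r : ℕ → ℕ) (o : ℕ),
    N.card < m → ComputesOn val (coset x₀ W) N l r F o →
      ConstOnSubcoset W F (N.card / 4 + 1)

/-- The exchange rate of the argument: removing four nodes lowers the bound by exactly one, which
pays for the one dimension lost. -/
lemma EliminatesBelow.step {x₁ : F2Vec n} {W' : Submodule (ZMod 2) (F2Vec n)} {N' : Finset ℕ}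
    (ih : EliminatesBelow val F N.card)
    (hW : Module.finrank (ZMod 2) W ≤ Module.finrank (ZMod 2) W' + 1)
    (hN' : N'.card + 4 = N.card)
    (hC : ∃ l' r' o', ComputesOn val (coset x₁ W') N' l' r' F o') :
    ConstOnSubcoset W F (N.card / 4 + 1) := by
  obtain ⟨l', r', o', hC⟩ := hC
  obtain ⟨x₂, W₂, h1, h2⟩ := ih x₁ W' N' l' r' o' (by omega) hC
  exact ⟨x₂, W₂, by omega, h2⟩

/-- Fixing the input `b` makes the gate `Q` constant, and the input `a` is read by `Q` only. -/
lemma ComputesOn.eliminate_single (hC : ComputesOn val (coset x₀ W) N l r F o)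
    (ih : EliminatesBelow val F N.card) (ho : ¬ AffineOn (coset x₀ W) (val o))
    (hread : ∀ v ∈ N, v ≠ o → ∃ w ∈ N, ¬ AffineOn (coset x₀ W) (val w) ∧ (l w = v ∨ r w = v))
    {a b Q : ℕ} (hQ : Q ∈ N) (hQA : ¬ AffineOn (coset x₀ W) (val Q)) (ha : a ∈ N) (hb : b ∈ N)
    (haA : AffineOn (coset x₀ W) (val a)) (hbA : AffineOn (coset x₀ W) (val b)) (hab : a ≠ b)
    {x₁ : F2Vec n} (hx₁ : x₁ ∈ coset x₀ W)
    (hconst : ∃ c, ∀ x ∈ coset x₀ W, val b x = val b x₁ → val Q x = c)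
    (honly : ∀ w ∈ N, ¬ AffineOn (coset x₀ W) (val w) → l w = a ∨ r w = a → w = Q) :
    ConstOnSubcoset W F (N.card / 4 + 1) := by
  obtain ⟨W', hdim, hsub, hbc⟩ := hbA.exists_coset hx₁
  obtain ⟨c, hc⟩ := hconst
  have hQc : ∀ x ∈ coset x₁ W', val Q x = c := fun x hx => hc x (hsub hx) (hbc x hx)
  by_cases hoQ : Q = o
  · subst hoQ
    obtain ⟨h, hh⟩ := hC.out
    exact ⟨x₁, W', by omega, h c, fun x hx => by rw [hh x (hsub hx), hQc x hx]⟩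
  obtain ⟨T, hT, hTA, hTQ⟩ := hread Q hQ hoQ
  have hQT : Q < T := by
    rcases hTQ with h | h
    · exact h ▸ (hC.left T hT hTA).1
    · exact h ▸ (hC.right T hT hTA).1
  have haT : a ≠ T := fun h => hTA (h ▸ haA)
  have hbT : b ≠ T := fun h => hTA (h ▸ hbA)
  have haQ : a ≠ Q := fun h => hQA (h ▸ haA)
  have hbQ : b ≠ Q := fun h => hQA (h ▸ hbA)
  have hpos : ∀ v ∈ N, 0 < v := fun v hv => Nat.pos_of_ne_zero fun h => hC.pos (h ▸ hv)
  refine ih.step (N' := N \ ({b, Q, T} ∪ {a})) hdim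
    (card_sdiff_four (a := b) (b := Q) (c := T) (d := a) (by ext; simp) hbQ hbT hab.symm
      hQT.ne haQ.symm haT.symm hb hQ hT ha) (hC.remove hsub {b, Q, T} {a} ?_ ?_ ?_)
  · intro p hp
    simp only [Finset.mem_insert, Finset.mem_singleton] at hp
    rcases hp with rfl | rfl | rfl
    · exact ⟨0, hpos p hb, by simp, by simpa using (hpos a ha).ne, .of_const _ hbc⟩
    · exact ⟨0, hpos p hQ, by simp, by simpa using (hpos a ha).ne, .of_const _ hQc⟩
    -- The argument of `T` that takes over must not be `a`, which is being discarded. It is not,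
    -- because `T` lies above `Q` and only `Q` reads `a`.
    · obtain ⟨z, hz, hzN, hzp, hfac⟩ := hC.factors_of_reads hsub hT hTA hTQ c hQc
      refine ⟨z, hz, hzN, ?_, hfac⟩
      rw [Finset.mem_singleton]
      rintro rfl
      exact hQT.ne' (honly p hT hTA (by tauto))
  · intro w hw hwS hwU hwA
    have hwQ : w ≠ Q := fun h => hwS (by simp [h])
    simp only [Finset.mem_singleton]
    exact ⟨fun h => hwQ (honly w hw hwA (Or.inl h)), fun h => hwQ (honly w hw hwA (Or.inr h))⟩
  · rw [Finset.mem_singleton]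
    rintro rfl
    exact ho haA

/-- Fixing the input `a` makes the gate `Q` constant, and the input `a` is also read by another
gate `P`. -/
lemma ComputesOn.eliminate_double (hC : ComputesOn val (coset x₀ W) N l r F o)
    (ih : EliminatesBelow val F N.card)
    (hread : ∀ v ∈ N, v ≠ o → ∃ w ∈ N, ¬ AffineOn (coset x₀ W) (val w) ∧ (l w = v ∨ r w = v))
    {a Q P : ℕ} (hQ : Q ∈ N) (hQA : ¬ AffineOn (coset x₀ W) (val Q)) (ha : a ∈ N)
    (haA : AffineOn (coset x₀ W) (val a)) {x₁ : F2Vec n} (hx₁ : x₁ ∈ coset x₀ W)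
    (hconst : ∃ c, ∀ x ∈ coset x₀ W, val a x = val a x₁ → val Q x = c)
    (hP : P ∈ N) (hPA : ¬ AffineOn (coset x₀ W) (val P)) (hPa : l P = a ∨ r P = a)
    (hPQ : P ≠ Q) :
    ConstOnSubcoset W F (N.card / 4 + 1) := by
  obtain ⟨W', hdim, hsub, hac⟩ := haA.exists_coset hx₁
  obtain ⟨c, hc⟩ := hconst
  have hQc : ∀ x ∈ coset x₁ W', val Q x = c := fun x hx => hc x (hsub hx) (hac x hx)
  have hdone : ∀ v c, v = o → (∀ x ∈ coset x₁ W', val v x = c) →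
      ConstOnSubcoset W F (N.card / 4 + 1) := by
    rintro v c rfl hv
    obtain ⟨h, hh⟩ := hC.out
    exact ⟨x₁, W', by omega, h c, fun x hx => by rw [hh x (hsub hx), hv x hx]⟩
  have hpos : ∀ v ∈ N, 0 < v := fun v hv => Nat.pos_of_ne_zero fun h => hC.pos (h ▸ hv)
  have hlt : ∀ T ∈ N, ¬ AffineOn (coset x₀ W) (val T) → ∀ q, l T = q ∨ r T = q → q < T := by
    rintro T hT hTA q (rfl | rfl)
    · exact (hC.left T hT hTA).1
    · exact (hC.right T hT hTA).1
  -- Three of the four nodes are already settled: `a` and `Q` are constant and `P` has a constant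
  -- argument. Any further gate with a constant argument is the fourth.
  have hfin : ∀ T ∈ N, ¬ AffineOn (coset x₀ W) (val T) → T ≠ Q → T ≠ P →
      (∃ q c, (l T = q ∨ r T = q) ∧ ∀ x ∈ coset x₁ W', val q x = c) →
      ConstOnSubcoset W F (N.card / 4 + 1) := by
    rintro T hT hTA hTQ hTP ⟨q, c', hTq, hq⟩
    refine ih.step (N' := N \ ({a, Q, P, T} ∪ ∅)) hdim
      (card_sdiff_four (a := a) (b := Q) (c := P) (d := T) (by simp) (fun h => hQA (h ▸ haA))
        (fun h => hPA (h ▸ haA)) (fun h => hTA (h ▸ haA)) hPQ.symm hTQ.symm hTP.symm ha hQ hP hT)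
      (hC.remove hsub {a, Q, P, T} ∅ ?_ (by simp) (by simp))
    intro p hp
    simp only [Finset.mem_insert, Finset.mem_singleton] at hp
    rcases hp with rfl | rfl | rfl | rfl
    · exact ⟨0, hpos p ha, by simp, by simp, .of_const _ hac⟩
    · exact ⟨0, hpos p hQ, by simp, by simp, .of_const _ hQc⟩
    · obtain ⟨z, hz, hzN, -, hfac⟩ := hC.factors_of_reads hsub hP hPA hPa _ hac
      exact ⟨z, hz, hzN, by simp, hfac⟩
    · obtain ⟨z, hz, hzN, -, hfac⟩ := hC.factors_of_reads hsub hT hTA hTq _ hq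
      exact ⟨z, hz, hzN, by simp, hfac⟩
  by_cases hoQ : Q = o
  · exact hdone Q c hoQ hQc
  obtain ⟨T, hT, hTA, hTQ⟩ := hread Q hQ hoQ
  -- If the reader of `Q` is `P`, both arguments of `P` are constant, so `P` is constant as well,
  -- and the fourth node is found among the readers of `P`.
  by_cases hTP : T = P
  · subst hTP
    have hQT := hlt T hT hTA Q hTQ
    have haQ : a ≠ Q := fun h => hQA (h ▸ haA)
    obtain ⟨op, hop⟩ := hC.gate T hT hTA
    have hTc : ∃ c', ∀ x ∈ coset x₁ W', val T x = c' := by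
      have : (l T = a ∧ r T = Q) ∨ (l T = Q ∧ r T = a) := by
        rcases hTQ with h | h <;> rcases hPa with h' | h'
        · exact absurd (h'.symm.trans h) haQ
        · exact Or.inr ⟨h, h'⟩
        · exact Or.inl ⟨h', h⟩
        · exact absurd (h'.symm.trans h) haQ
      rcases this with ⟨h, h'⟩ | ⟨h, h'⟩
      · exact ⟨op (val a x₁) c, fun x hx => by rw [hop x (hsub hx), h, h', hac x hx, hQc x hx]⟩
      · exact ⟨op c (val a x₁), fun x hx => by rw [hop x (hsub hx), h, h', hac x hx, hQc x hx]⟩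
    obtain ⟨c', hTc⟩ := hTc
    by_cases hoT : T = o
    · exact hdone T c' hoT hTc
    obtain ⟨T', hT', hTA', hTT'⟩ := hread T hT hoT
    have := hlt T' hT' hTA' T hTT'
    exact hfin T' hT' hTA' (by omega) (by omega) ⟨T, c', hTT', hTc⟩
  · exact hfin T hT hTA (hlt T hT hTA Q hTQ).ne' hTP ⟨Q, c, hTQ, hQc⟩

end Step

/-- A circuit with `m` nodes is constant on a coset of codimension at most `m / 4 + 1`. -/
theorem ComputesOn.constOnSubcoset (F : F2Vec n → Bool) (hval : ∀ x, val 0 x = false) (m : ℕ) :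
    EliminatesBelow val F m := by
  induction m with
  | zero => intro _ _ _ _ _ _ h; omega
  | succ m ihm =>
    intro x₀ W N l r o hm hC
    have ih : EliminatesBelow val F N.card := fun _ _ _ _ _ _ h => ihm _ _ _ _ _ _ (by omega)
    -- An affine output is made constant by one last equation, which accounts for the summand `1` in
    -- the bound.
    by_cases ho : AffineOn (coset x₀ W) (val o)
    · obtain ⟨W', hdim, hsub, hc⟩ := ho.exists_coset (self_mem_coset x₀ W)
      obtain ⟨h, hh⟩ := hC.out
      exact ⟨x₀, W', by omega, h (val o x₀), fun x hx => by rw [hh x (hsub hx), hc x hx]⟩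
    have hpos : ∀ v ∈ N, 0 < v := fun v hv => Nat.pos_of_ne_zero fun h => hC.pos (h ▸ hv)
    -- Redundant nodes are dropped on the same coset, at no cost in dimension; afterwards no node is
    -- a function of an earlier one and each node but the output is read by a non-affine gate.
    have hsmall : ∀ v ∈ N, (∃ l' r' o', ComputesOn val (coset x₀ W) (N \ {v}) l' r' F o') →
        ConstOnSubcoset W F (N.card / 4 + 1) := by
      rintro v hv ⟨l', r', o', hC'⟩
      have hcard : (N \ {v}).card < N.card :=
        Finset.card_lt_card (Finset.sdiff_ssubset (by simpa using hv) (by simp))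
      exact (ih x₀ W _ l' r' o' hcard hC').mono (by omega)
    by_cases hfac : ∃ v ∈ N, ∃ z < v, z ∈ insert 0 N ∧ FactorsOn val (coset x₀ W) (val v) z
    · obtain ⟨v, hv, z, hz, hzN, hfac⟩ := hfac
      refine hsmall v hv ?_
      have := hC.remove subset_rfl {v} ∅ (fun p hp => by
        obtain rfl := Finset.mem_singleton.1 hp
        exact ⟨z, hz, hzN, by simp, hfac⟩) (by simp) (by simp)
      simpa using this
    by_cases hread : ∀ v ∈ N, v ≠ o →
        ∃ w ∈ N, ¬ AffineOn (coset x₀ W) (val w) ∧ (l w = v ∨ r w = v)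
    swap
    · push Not at hread
      obtain ⟨v, hv, hvo, hw⟩ := hread
      refine hsmall v hv ?_
      have := hC.remove subset_rfl ∅ {v} (by simp) (fun w hwN _ _ hwA => by
        simpa using hw w hwN hwA) (by simpa using hvo.symm)
      simpa using this
    push Not at hfac
    have hoN : o ∈ N := by
      rcases Finset.mem_insert.1 hC.out_mem with rfl | h
      · exact absurd (AffineOn.of_const false fun x _ => hval x) ho
      · exact h
    classical
    obtain ⟨Q, hQmem, hQmin⟩ := Finset.exists_min_image
      (N.filter fun v => ¬ AffineOn (coset x₀ W) (val v)) id ⟨o, by simp [hoN, ho]⟩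
    simp only [Finset.mem_filter, id, and_imp] at hQmem hQmin
    obtain ⟨hQ, hQA⟩ := hQmem
    have hinput : ∀ a, a < Q → a ∈ insert 0 N → AffineOn (coset x₀ W) (val a) := by
      intro a haQ ha
      rcases Finset.mem_insert.1 ha with rfl | ha
      · exact AffineOn.of_const false fun x _ => hval x
      · by_contra h
        exact absurd (hQmin a ha h) (by omega)
    obtain ⟨haQ, ha⟩ := hC.left Q hQ hQA
    obtain ⟨hbQ, hb⟩ := hC.right Q hQ hQA
    obtain ⟨op, hop⟩ := hC.gate Q hQ hQA
    have haA := hinput _ haQ ha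
    have hbA := hinput _ hbQ hb
    have haN : l Q ∈ N := (Finset.mem_insert.1 ha).resolve_left fun h =>
      hfac Q hQ _ hbQ hb (.of_gate subset_rfl ⟨op, hop⟩ false fun x _ => by rw [h, hval])
    have hbN : r Q ∈ N := (Finset.mem_insert.1 hb).resolve_left fun h =>
      hfac Q hQ _ haQ ha (.of_gate subset_rfl (exists_swap_gate ⟨op, hop⟩) false
        fun x _ => by rw [h, hval])
    have hne : l Q ≠ r Q := fun h => hfac Q hQ _ haQ ha
      ⟨fun a => op a a, fun x hx => by rw [hop x hx, ← h]⟩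
    -- A constant node would be a function of node `0`, contrary to `hfac`. Hence the value that
    -- makes `Q` constant is attained by its argument.
    have hsurj : ∀ v ∈ N, ∀ c, ∃ x ∈ coset x₀ W, val v x = c := by
      intro v hv c
      by_contra! h
      exact hfac v hv 0 (hpos v hv) (by simp) (.of_const (!c) fun x hx => by
        have := h x hx
        revert this
        cases val v x <;> cases c <;> simp)
    -- The first two types make `Q` a function of one argument, against irredundancy, and the third
    -- makes `Q` affine. Only gates that either argument can freeze remain.
    rcases bool_op_cases op with ⟨h, hh⟩ | ⟨h, hh⟩ | ⟨c, hh⟩ | ⟨⟨α, cα, hα⟩, β, cβ, hβ⟩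
    · exact (hfac Q hQ _ haQ ha ⟨h, fun x hx => by rw [hop x hx, hh]⟩).elim
    · exact (hfac Q hQ _ hbQ hb ⟨h, fun x hx => by rw [hop x hx, hh]⟩).elim
    · exact (hQA (haA.xor hbA c fun x hx => by rw [hop x hx, hh])).elim
    by_cases honly : ∀ w ∈ N, ¬ AffineOn (coset x₀ W) (val w) → l w = l Q ∨ r w = l Q → w = Q
    · obtain ⟨x₁, hx₁, hx₁β⟩ := hsurj _ hbN β
      exact hC.eliminate_single ih ho hread hQ hQA haN hbN haA hbA hne hx₁
        ⟨cβ, fun x hx h => by rw [hop x hx, h, hx₁β, hβ]⟩ honly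
    · push Not at honly
      obtain ⟨P, hP, hPA, hPa, hPQ⟩ := honly
      obtain ⟨x₁, hx₁, hx₁α⟩ := hsurj _ haN α
      exact hC.eliminate_double ih hread hQ hQA haN haA hx₁
        ⟨cα, fun x hx h => by rw [hop x hx, h, hx₁α, hα]⟩ hP hPA hPa hPQ

end LowerBound

/-! ### The wires of a circuit -/

/-- The values of all wires, when the values of the first wires are given. -/
def wireValues (gates : List B2Gate) (vals : List Bool) : List Bool :=
  gates.foldl (fun vals g => vals ++ [g.eval vals]) vals

@[simp] lemma wireValues_nil (vals : List Bool) : wireValues [] vals = vals := rfl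

@[simp] lemma wireValues_cons (g : B2Gate) (gates : List B2Gate) (vals : List Bool) :
    wireValues (g :: gates) vals = wireValues gates (vals ++ [g.eval vals]) := rfl

@[simp] lemma length_wireValues (gates : List B2Gate) (vals : List Bool) :
    (wireValues gates vals).length = vals.length + gates.length := by
  induction gates generalizing vals with
  | nil => simp
  | cons g gates ih => simp [ih]; omega

lemma getD_wireValues_of_lt (gates : List B2Gate) (vals : List Bool) {i : ℕ}
    (hi : i < vals.length) : (wireValues gates vals).getD i false = vals.getD i false := by
  induction gates generalizing vals with
  | nil => simp
  | cons g gates ih =>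
    rw [wireValues_cons, ih _ (by simp; omega), List.getD_append _ _ _ _ hi]

lemma B2Gate.eval_congr {g : B2Gate} {m : ℕ} (hg : g.ReadsBelow m) {v v' : List Bool}
    (h : ∀ i < m, v.getD i false = v'.getD i false) : g.eval v = g.eval v' := by
  cases g with
  | const b => rfl
  | unary op i => simp only [B2Gate.eval, h i hg]
  | binary op i j => simp only [B2Gate.eval, h i hg.1, h j hg.2]

/-- Evaluation only appends, and a gate reads only earlier entries, so it may as well be evaluated
in the final list. The order of evaluation thereby disappears from the gate equations. -/
lemma getD_wireValues_gate (gates : List B2Gate) (vals : List Bool) {k : ℕ}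
    (hk : k < gates.length) (hg : (gates[k]).ReadsBelow (vals.length + k)) :
    (wireValues gates vals).getD (vals.length + k) false =
      (gates[k]).eval (wireValues gates vals) := by
  induction gates generalizing vals k with
  | nil => simp at hk
  | cons g gates ih =>
    cases k with
    | zero =>
      rw [wireValues_cons, getD_wireValues_of_lt _ _ (by simp)]
      simp only [List.getElem_cons_zero, Nat.add_zero] at hg ⊢
      rw [List.getD_append_right _ _ _ _ le_rfl]
      simp only [Nat.sub_self, List.getD_cons_zero]
      refine B2Gate.eval_congr hg fun i hi => ?_
      rw [getD_wireValues_of_lt _ _ (by simp; omega), List.getD_append _ _ _ _ hi]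
    | succ k =>
      have := ih (vals ++ [g.eval vals]) (k := k) (by simpa using hk) (by
        have h : vals.length + (k + 1) = vals.length + 1 + k := by omega
        simpa [h] using hg)
      have h : vals.length + (k + 1) = (vals ++ [g.eval vals]).length + k := by simp; omega
      rw [wireValues_cons, h, this]
      rfl

lemma card_filter_getElem? {α : Type*} (p : α → Bool) (L : List α) :
    ((Finset.range L.length).filter fun k => (L[k]?).any p = true).card = L.countP p := by
  induction L using List.reverseRecOn with
  | nil => simp
  | append_singleton L a ih =>
    rw [List.length_append, List.length_singleton, Finset.range_add_one, Finset.filter_insert,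
      List.countP_append, ← ih]
    have h : ((Finset.range L.length).filter fun k => ((L ++ [a])[k]?).any p = true) =
        (Finset.range L.length).filter fun k => (L[k]?).any p = true := by
      refine Finset.filter_congr fun k hk => ?_
      rw [List.getElem?_append_left (Finset.mem_range.1 hk)]
    rw [h]
    by_cases ha : p a <;> simp [ha]

/-- A vector over the field with two elements as a vector of truth values. -/
def F2Vec.toBits {n : ℕ} (x : F2Vec n) : Fin n → Bool := fun i => decide (x i = 1)

/-- The nodes of a circuit: node `0` is constant and node `i + 1` is wire `i`. -/
def B2Circuit.node {n : ℕ} (C : B2Circuit n) : ℕ → F2Vec n → Bool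
  | 0, _ => false
  | i + 1, x => (C.wires x.toBits).getD i false

/-- The nodes read by a node. -/
def B2Circuit.reads {n : ℕ} (C : B2Circuit n) (v : ℕ) : ℕ × ℕ :=
  match C.gates[v - (n + 1)]? with
  | some (.binary _ i j) => (i + 1, j + 1)
  | some (.unary _ i) => (i + 1, 0)
  | _ => (0, 0)

lemma B2Circuit.node_input {n : ℕ} (C : B2Circuit n) {i : ℕ} (hi : i < n) (x : F2Vec n) :
    C.node (i + 1) x = decide (x ⟨i, hi⟩ = 1) := by
  have := getD_wireValues_of_lt C.gates (List.ofFn x.toBits) (i := i) (by simpa using hi)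
  refine this.trans ?_
  rw [List.getD_eq_getElem _ _ (by simpa using hi)]
  simp [F2Vec.toBits]

lemma B2Circuit.node_gate {n : ℕ} (C : B2Circuit n) {k : ℕ} (hk : k < C.gates.length)
    (x : F2Vec n) : C.node (n + k + 1) x = (C.gates[k]).eval (C.wires x.toBits) := by
  have := getD_wireValues_gate C.gates (List.ofFn x.toBits) hk (by simpa using C.gates_ok k hk)
  rw [List.length_ofFn] at this
  exact this

lemma B2Circuit.computesOn {n : ℕ} (C : B2Circuit n) (A : Set (F2Vec n)) :
    ComputesOn C.node A (Finset.Icc 1 (n + C.gates.length)) (fun v => (C.reads v).1)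
      (fun v => (C.reads v).2) (fun x => C.eval x.toBits) (C.out + 1) := by
  -- Inputs are coordinate functions, hence affine, so non-affine nodes are gates. The meaningless
  -- value of `B2Circuit.reads` at an input, caused by truncated subtraction, therefore never
  -- matters.
  have hgate : ∀ v ∈ Finset.Icc 1 (n + C.gates.length), ¬ AffineOn A (C.node v) →
      ∃ k, ∃ _ : k < C.gates.length, v = n + k + 1 ∧ v - (n + 1) = k := by
    intro v hv hvA
    rw [Finset.mem_Icc] at hv
    by_contra! h
    have hvn : v ≤ n := by
      by_contra hvn
      exact h (v - (n + 1)) (by omega) (by omega) rfl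
    obtain ⟨i, rfl⟩ : ∃ i, v = i + 1 := ⟨v - 1, by omega⟩
    exact hvA ⟨LinearMap.proj ⟨i, hvn⟩, false, fun x _ => by
      rw [C.node_input hvn, Bool.xor_false]; rfl⟩
  have hmem : ∀ m, m ≤ n + C.gates.length →
      m ∈ insert 0 (Finset.Icc 1 (n + C.gates.length)) := fun m hm => by
    simp only [Finset.mem_insert, Finset.mem_Icc]; omega
  refine ⟨by simp, ?_, ?_, ?_, ?_, id, fun x _ => rfl⟩
  · intro v hv hvA
    obtain ⟨k, hk, rfl, hvk⟩ := hgate v hv hvA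
    have hok := C.gates_ok k hk
    simp only [B2Circuit.reads, hvk, List.getElem?_eq_getElem hk]
    cases hg : C.gates[k] <;> simp only [hg, B2Gate.ReadsBelow] at hok ⊢ <;>
      exact ⟨by omega, hmem _ (by omega)⟩
  · intro v hv hvA
    obtain ⟨k, hk, rfl, hvk⟩ := hgate v hv hvA
    have hok := C.gates_ok k hk
    simp only [B2Circuit.reads, hvk, List.getElem?_eq_getElem hk]
    cases hg : C.gates[k] <;> simp only [hg, B2Gate.ReadsBelow] at hok ⊢ <;>
      exact ⟨by omega, hmem _ (by omega)⟩
  · intro v hv hvA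
    obtain ⟨k, hk, rfl, hvk⟩ := hgate v hv hvA
    simp only [B2Circuit.reads, hvk, List.getElem?_eq_getElem hk, C.node_gate hk]
    cases hg : C.gates[k] with
    | const b => exact ⟨fun _ _ => b, fun x _ => rfl⟩
    | unary op i => exact ⟨fun a _ => op a, fun x _ => rfl⟩
    | binary op i j => exact ⟨op, fun x _ => rfl⟩
  · have := C.out_ok
    exact hmem _ (by omega)

/-- The nodes of a circuit that are not computed by a binary gate can be removed, apart from the
inputs. -/
lemma B2Circuit.exists_computesOn {n : ℕ} (C : B2Circuit n) (A : Set (F2Vec n)) :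
    ∃ (N : Finset ℕ) (l r : ℕ → ℕ) (o : ℕ), N.card ≤ n + C.size ∧
      ComputesOn C.node A N l r (fun x => C.eval x.toBits) o := by
  classical
  set G := (Finset.range C.gates.length).filter fun k => (C.gates[k]?).any B2Gate.isBinary = true
    with hG
  set S := (Finset.range C.gates.length).filter fun k =>
    (C.gates[k]?).any B2Gate.isBinary = false with hS
  obtain ⟨l, r, o, h⟩ := (C.computesOn A).remove subset_rfl (S.image fun k => n + k + 1) ∅ (by
    intro p hp
    obtain ⟨k, hk, rfl⟩ := Finset.mem_image.1 hp
    simp only [hS, Finset.mem_filter, Finset.mem_range] at hk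
    obtain ⟨hk, hnb⟩ := hk
    rw [List.getElem?_eq_getElem hk] at hnb
    have hok := C.gates_ok k hk
    have hnode := C.node_gate hk
    cases hg : C.gates[k] with
    | const b =>
      exact ⟨0, by omega, by simp, by simp, .of_const b fun x _ => by rw [hnode, hg]; rfl⟩
    | unary op i =>
      simp only [hg, B2Gate.ReadsBelow] at hok
      exact ⟨i + 1, by omega, by simp; omega, by simp, op, fun x _ => by rw [hnode, hg]; rfl⟩
    | binary op i j => simp [hg, B2Gate.isBinary] at hnb) (by simp) (by simp)
  refine ⟨_, l, r, o, ?_, h⟩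
  have hsub : Finset.Icc 1 (n + C.gates.length) \ ((S.image fun k => n + k + 1) ∪ ∅) ⊆
      Finset.Icc 1 n ∪ G.image fun k => n + k + 1 := by
    intro v hv
    simp only [hS, hG, Finset.mem_sdiff, Finset.mem_Icc, Finset.union_empty, Finset.mem_image,
      Finset.mem_filter, Finset.mem_range, Finset.mem_union, not_exists, not_and] at hv ⊢
    by_cases hvn : v ≤ n
    · exact Or.inl ⟨hv.1.1, hvn⟩
    · refine Or.inr ⟨v - (n + 1), ⟨by omega, ?_⟩, by omega⟩
      have := hv.2 (v - (n + 1))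
      by_contra hb
      exact this ⟨by omega, by simpa using hb⟩ (by omega)
  refine (Finset.card_le_card hsub).trans ((Finset.card_union_le _ _).trans ?_)
  have h1 : (G.image fun k => n + k + 1).card ≤ G.card := Finset.card_image_le
  have h2 : G.card = C.size := card_filter_getElem? _ _
  simp only [Nat.card_Icc]
  omega

/-- A circuit of size less than `3n - 4d - 4` does not compute an affine disperser of
dimension `d`. -/
theorem IsAffineDisperser.exists_ne {f : List Bool → Bool} {n d : ℕ}
    (hf : IsAffineDisperser d (sliceF2 f n)) (C : B2Circuit n)
    (hC : C.size + 4 * d + 4 < 3 * n) :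
    ∃ x : Fin n → Bool, C.eval x ≠ f (List.ofFn x) := by
  by_contra! hCf
  obtain ⟨N, l, r, o, hN, hcomp⟩ := C.exists_computesOn (coset 0 ⊤)
  -- The elimination starts on the whole space; the size hypothesis leaves a coset of dimension at
  -- least `d`.
  obtain ⟨x₁, W, hW, c, hc⟩ := ComputesOn.constOnSubcoset (val := C.node)
    (fun x => C.eval x.toBits) (fun _ => rfl) (N.card + 1) 0 ⊤ N l r o (by omega) hcomp
  rw [finrank_top, Module.finrank_fin_fun] at hW
  obtain ⟨x, hx, y, hy, hxy⟩ := hf (AffineSubspace.mk' x₁ W) ⟨x₁, AffineSubspace.self_mem_mk' _ _⟩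
    (by
      have h := congrArg (fun V : Submodule (ZMod 2) (F2Vec n) => Module.finrank (ZMod 2) V)
        (AffineSubspace.direction_mk' x₁ W)
      exact (show d ≤ Module.finrank (ZMod 2) W by omega).trans h.ge)
  refine hxy ?_
  rw [AffineSubspace.mem_mk', vsub_eq_sub] at hx hy
  have hx' := hc x hx
  have hy' := hc y hy
  simp only [hCf] at hx' hy'
  exact hx'.trans hy'.symm

/-! ### Running programs -/

namespace OracleProg

variable {A : Language Bool}

lemma Runs.congr {c : OracleProg} {σ τ τ' : Store} {t t' : ℕ} (h : c.Runs A σ t τ)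
    (ht : t = t') (hτ : τ = τ') : c.Runs A σ t' τ' := by
  subst ht hτ
  exact h

/-- At most one rule applies in any situation. This identifies the store given by a time bound with
the store given by a correctness proof. -/
theorem Runs.final_unique {c : OracleProg} {σ τ τ' : Store} {t t' : ℕ} (h : c.Runs A σ t τ)
    (h' : c.Runs A σ t' τ') : τ = τ' := by
  induction h generalizing t' τ' with
  | skip σ => cases h'; rfl
  | push r b σ => cases h'; rfl
  | seq _ _ ih₁ ih₂ =>
    cases h' with
    | seq h₁ h₂ =>
      obtain rfl := ih₁ h₁
      exact ih₂ h₂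
  | popEmpty hr _ ih => cases h' <;> (simp_all; try exact ih ‹_›)
  | popFalse hr _ ih => cases h' <;> (simp_all; try exact ih ‹_›)
  | popTrue hr _ ih => cases h' <;> (simp_all; try exact ih ‹_›)
  | loopDone hr =>
    cases h' with
    | loopDone _ => rfl
    | loopStep hr' _ _ => exact absurd hr hr'
  | loopStep hr _ _ ih₁ ih₂ =>
    cases h' with
    | loopDone hr' => exact absurd hr' hr
    | loopStep _ h₁ h₂ =>
      obtain rfl := ih₁ h₁
      exact ih₂ h₂
  | queryYes hr _ ih =>
    cases h' with
    | queryYes _ h => exact ih h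
    | queryNo hr' _ => exact absurd hr hr'
  | queryNo hr _ ih =>
    cases h' with
    | queryYes hr' _ => exact absurd hr' hr
    | queryNo _ h => exact ih h

/-- The program `c` started on `σ` halts and leaves `τ`. -/
def Exec (A : Language Bool) (c : OracleProg) (σ τ : Store) : Prop := ∃ t, c.Runs A σ t τ

lemma Exec.unique {c : OracleProg} {σ τ τ' : Store} (h : c.Exec A σ τ) (h' : c.Exec A σ τ') :
    τ = τ' := h.choose_spec.final_unique h'.choose_spec

/-- By determinism a single known run describes all runs, so execution becomes an equation and
`simp` can run programs symbolically. -/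
lemma Exec.iff_eq {c : OracleProg} {σ τ τ' : Store} (h : c.Exec A σ τ) :
    c.Exec A σ τ' ↔ τ' = τ :=
  ⟨fun h' => h'.unique h, fun h' => h' ▸ h⟩

@[simp] lemma exec_skip {σ τ : Store} : Exec A .skip σ τ ↔ τ = σ :=
  Exec.iff_eq ⟨_, .skip σ⟩

@[simp] lemma exec_push {r : ℕ} {b : Bool} {σ τ : Store} :
    Exec A (.push r b) σ τ ↔ τ = Function.update σ r (b :: σ r) :=
  Exec.iff_eq ⟨_, .push r b σ⟩

@[simp] lemma exec_seq {c₁ c₂ : OracleProg} {σ τ : Store} :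
    Exec A (.seq c₁ c₂) σ τ ↔ ∃ σ', Exec A c₁ σ σ' ∧ Exec A c₂ σ' τ := by
  constructor
  · rintro ⟨t, h⟩
    cases h with
    | seq h₁ h₂ => exact ⟨_, ⟨_, h₁⟩, ⟨_, h₂⟩⟩
  · rintro ⟨σ', ⟨_, h₁⟩, ⟨_, h₂⟩⟩
    exact ⟨_, .seq h₁ h₂⟩

/-- Remove the top bit `b` of stack `r` and run `k b`; if the stack is empty, run `cE`. -/
def onTop (r : ℕ) (cE : OracleProg) (k : Bool → OracleProg) : OracleProg :=
  .pop r cE (k false) (k true)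

/-- Case distinction between an empty and a nonempty stack. -/
def topCases (l : List Bool) (pE : Prop) (p : Bool → List Bool → Prop) : Prop :=
  match l with
  | [] => pE
  | b :: l => p b l

@[simp] lemma topCases_nil (pE : Prop) (p : Bool → List Bool → Prop) :
    topCases [] pE p ↔ pE := Iff.rfl

@[simp] lemma topCases_cons (b : Bool) (l : List Bool) (pE : Prop)
    (p : Bool → List Bool → Prop) : topCases (b :: l) pE p ↔ p b l := Iff.rfl

lemma Runs.onTop_nil {r : ℕ} {cE : OracleProg} {k : Bool → OracleProg} {σ τ : Store} {t : ℕ}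
    (hr : σ r = []) (h : cE.Runs A σ t τ) : (onTop r cE k).Runs A σ (t + 1) τ :=
  .popEmpty hr h

lemma Runs.onTop_cons {r : ℕ} {cE : OracleProg} {k : Bool → OracleProg} {σ τ : Store} {t : ℕ}
    {b : Bool} {l : List Bool} (hr : σ r = b :: l)
    (h : (k b).Runs A (Function.update σ r l) t τ) : (onTop r cE k).Runs A σ (t + 1) τ := by
  cases b
  · exact .popFalse hr h
  · exact .popTrue hr h

@[simp] lemma exec_onTop {r : ℕ} {cE : OracleProg} {k : Bool → OracleProg} {σ τ : Store} :
    Exec A (onTop r cE k) σ τ ↔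
      topCases (σ r) (Exec A cE σ τ) fun b l => Exec A (k b) (Function.update σ r l) τ := by
  constructor
  · rintro ⟨t, h⟩
    cases h with
    | popEmpty hr h => rw [hr]; exact ⟨_, h⟩
    | popFalse hr h => rw [hr]; exact ⟨_, h⟩
    | popTrue hr h => rw [hr]; exact ⟨_, h⟩
  · intro h
    cases hr : σ r with
    | nil =>
      rw [hr] at h
      obtain ⟨t, h⟩ := h
      exact ⟨_, .onTop_nil hr h⟩
    | cons b l =>
      rw [hr] at h
      obtain ⟨t, h⟩ := h
      exact ⟨_, .onTop_cons hr h⟩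

lemma exec_loop_nil {r : ℕ} {c : OracleProg} {σ τ : Store} (hr : σ r = []) :
    Exec A (.loop r c) σ τ ↔ τ = σ :=
  Exec.iff_eq ⟨_, .loopDone hr⟩

lemma exec_loop_ne_nil {r : ℕ} {c : OracleProg} {σ τ : Store} (hr : σ r ≠ []) :
    Exec A (.loop r c) σ τ ↔ ∃ σ', Exec A c σ σ' ∧ Exec A (.loop r c) σ' τ := by
  constructor
  · rintro ⟨t, h⟩
    cases h with
    | loopDone hr' => exact absurd hr' hr
    | loopStep _ h₁ h₂ => exact ⟨_, ⟨_, h₁⟩, ⟨_, h₂⟩⟩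
  · rintro ⟨σ', ⟨_, h₁⟩, ⟨_, h₂⟩⟩
    exact ⟨_, .loopStep hr h₁ h₂⟩

@[simp] lemma exec_query {r : ℕ} {cY cN : OracleProg} {σ τ : Store} :
    Exec A (.query r cY cN) σ τ ↔
      (σ r ∈ A ∧ Exec A cY σ τ) ∨ (σ r ∉ A ∧ Exec A cN σ τ) := by
  constructor
  · rintro ⟨t, h⟩
    cases h with
    | queryYes hr h => exact Or.inl ⟨hr, _, h⟩
    | queryNo hr h => exact Or.inr ⟨hr, _, h⟩
  · rintro (⟨hr, t, h⟩ | ⟨hr, t, h⟩)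
    · exact ⟨_, .queryYes hr h⟩
    · exact ⟨_, .queryNo hr h⟩

/-! ### Seven working stacks, followed by the stacks of another program -/

end OracleProg

/-- The store with the given contents on the stacks `0, …, 6`, and `ρ` on the stacks from `7` on. -/
def mkStore (a₀ a₁ a₂ a₃ a₄ a₅ a₆ : List Bool) (ρ : Store) : Store
  | 0 => a₀
  | 1 => a₁
  | 2 => a₂
  | 3 => a₃
  | 4 => a₄
  | 5 => a₅
  | 6 => a₆
  | k + 7 => ρ k

section mkStore

variable (a₀ a₁ a₂ a₃ a₄ a₅ a₆ v : List Bool) (ρ : Store)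

@[simp] lemma mkStore_zero : mkStore a₀ a₁ a₂ a₃ a₄ a₅ a₆ ρ 0 = a₀ := rfl
@[simp] lemma mkStore_one : mkStore a₀ a₁ a₂ a₃ a₄ a₅ a₆ ρ 1 = a₁ := rfl
@[simp] lemma mkStore_two : mkStore a₀ a₁ a₂ a₃ a₄ a₅ a₆ ρ 2 = a₂ := rfl
@[simp] lemma mkStore_three : mkStore a₀ a₁ a₂ a₃ a₄ a₅ a₆ ρ 3 = a₃ := rfl
@[simp] lemma mkStore_four : mkStore a₀ a₁ a₂ a₃ a₄ a₅ a₆ ρ 4 = a₄ := rfl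
@[simp] lemma mkStore_five : mkStore a₀ a₁ a₂ a₃ a₄ a₅ a₆ ρ 5 = a₅ := rfl
@[simp] lemma mkStore_six : mkStore a₀ a₁ a₂ a₃ a₄ a₅ a₆ ρ 6 = a₆ := rfl
@[simp] lemma mkStore_seven : mkStore a₀ a₁ a₂ a₃ a₄ a₅ a₆ ρ 7 = ρ 0 := rfl
lemma mkStore_add (k : ℕ) : mkStore a₀ a₁ a₂ a₃ a₄ a₅ a₆ ρ (k + 7) = ρ k := rfl

lemma store_ext {σ τ : Store} (h0 : σ 0 = τ 0) (h1 : σ 1 = τ 1) (h2 : σ 2 = τ 2) (h3 : σ 3 = τ 3)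
    (h4 : σ 4 = τ 4) (h5 : σ 5 = τ 5) (h6 : σ 6 = τ 6) (h : ∀ k, σ (k + 7) = τ (k + 7)) :
    σ = τ := by
  funext r
  match r with
  | 0 => exact h0
  | 1 => exact h1
  | 2 => exact h2
  | 3 => exact h3
  | 4 => exact h4
  | 5 => exact h5
  | 6 => exact h6
  | k + 7 => exact h k

@[simp] lemma update_mkStore_zero : Function.update (mkStore a₀ a₁ a₂ a₃ a₄ a₅ a₆ ρ) 0 v =
    mkStore v a₁ a₂ a₃ a₄ a₅ a₆ ρ := by
  apply store_ext <;> first | rfl | exact fun k => rfl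
@[simp] lemma update_mkStore_one : Function.update (mkStore a₀ a₁ a₂ a₃ a₄ a₅ a₆ ρ) 1 v =
    mkStore a₀ v a₂ a₃ a₄ a₅ a₆ ρ := by
  apply store_ext <;> first | rfl | exact fun k => rfl
@[simp] lemma update_mkStore_two : Function.update (mkStore a₀ a₁ a₂ a₃ a₄ a₅ a₆ ρ) 2 v =
    mkStore a₀ a₁ v a₃ a₄ a₅ a₆ ρ := by
  apply store_ext <;> first | rfl | exact fun k => rfl
@[simp] lemma update_mkStore_three : Function.update (mkStore a₀ a₁ a₂ a₃ a₄ a₅ a₆ ρ) 3 v =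
    mkStore a₀ a₁ a₂ v a₄ a₅ a₆ ρ := by
  apply store_ext <;> first | rfl | exact fun k => rfl
@[simp] lemma update_mkStore_four : Function.update (mkStore a₀ a₁ a₂ a₃ a₄ a₅ a₆ ρ) 4 v =
    mkStore a₀ a₁ a₂ a₃ v a₅ a₆ ρ := by
  apply store_ext <;> first | rfl | exact fun k => rfl
@[simp] lemma update_mkStore_five : Function.update (mkStore a₀ a₁ a₂ a₃ a₄ a₅ a₆ ρ) 5 v =
    mkStore a₀ a₁ a₂ a₃ a₄ v a₆ ρ := by
  apply store_ext <;> first | rfl | exact fun k => rfl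
@[simp] lemma update_mkStore_six : Function.update (mkStore a₀ a₁ a₂ a₃ a₄ a₅ a₆ ρ) 6 v =
    mkStore a₀ a₁ a₂ a₃ a₄ a₅ v ρ := by
  apply store_ext <;> first | rfl | exact fun k => rfl

lemma update_mkStore_add (k : ℕ) : Function.update (mkStore a₀ a₁ a₂ a₃ a₄ a₅ a₆ ρ) (k + 7) v =
    mkStore a₀ a₁ a₂ a₃ a₄ a₅ a₆ (Function.update ρ k v) := by
  apply store_ext <;> first | rfl | skip
  intro j
  by_cases h : j = k
  · subst h; simp [mkStore_add]
  · rw [Function.update_of_ne (by omega), mkStore_add, mkStore_add, Function.update_of_ne h]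

@[simp] lemma update_mkStore_seven : Function.update (mkStore a₀ a₁ a₂ a₃ a₄ a₅ a₆ ρ) 7 v =
    mkStore a₀ a₁ a₂ a₃ a₄ a₅ a₆ (Function.update ρ 0 v) := update_mkStore_add _ _ _ _ _ _ _ _ _ 0

lemma eq_mkStore (σ : Store) :
    σ = mkStore (σ 0) (σ 1) (σ 2) (σ 3) (σ 4) (σ 5) (σ 6) fun k => σ (k + 7) := by
  apply store_ext <;> first | rfl | exact fun k => rfl

lemma initStore_eq_mkStore (w : List Bool) :
    initStore w = mkStore w [] [] [] [] [] [] fun _ => [] := by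
  apply store_ext <;> first | rfl | exact fun k => rfl

end mkStore

namespace OracleProg

variable {A : Language Bool}

/-- The program that works on stack `r + 7` instead of stack `r`. -/
def shift : OracleProg → OracleProg
  | .skip => .skip
  | .push r b => .push (r + 7) b
  | .seq c₁ c₂ => .seq c₁.shift c₂.shift
  | .pop r cE cF cT => .pop (r + 7) cE.shift cF.shift cT.shift
  | .loop r c => .loop (r + 7) c.shift
  | .query r cY cN => .query (r + 7) cY.shift cN.shift

/-- Lets an arbitrary program serve as a subroutine: its stacks lie beyond the seven working stacks,
and neither its time nor its effect changes. -/
lemma Runs.shift {c : OracleProg} {ρ ρ' : Store} {t : ℕ} (h : c.Runs A ρ t ρ')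
    (a₀ a₁ a₂ a₃ a₄ a₅ a₆ : List Bool) :
    c.shift.Runs A (mkStore a₀ a₁ a₂ a₃ a₄ a₅ a₆ ρ) t (mkStore a₀ a₁ a₂ a₃ a₄ a₅ a₆ ρ') := by
  induction h with
  | skip σ => exact .skip _
  | push r b σ =>
    rw [← update_mkStore_add]
    exact .push _ _ _
  | seq _ _ ih₁ ih₂ => exact .seq ih₁ ih₂
  | popEmpty hr _ ih => exact .popEmpty hr ih
  | popFalse hr _ ih =>
    rw [← update_mkStore_add] at ih
    exact .popFalse hr ih
  | popTrue hr _ ih =>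
    rw [← update_mkStore_add] at ih
    exact .popTrue hr ih
  | loopDone hr => exact .loopDone hr
  | loopStep hr _ _ ih₁ ih₂ => exact .loopStep hr ih₁ ih₂
  | queryYes hr _ ih => exact .queryYes hr ih
  | queryNo hr _ ih => exact .queryNo hr ih

end OracleProg

/-! ### Programs with polynomial running time -/

/-- The number of bits on the working stacks. -/
def Store.size (σ : Store) : ℕ := ∑ r ∈ Finset.range 7, (σ r).length

lemma Store.size_update (σ : Store) {r : ℕ} (hr : r < 7) (l : List Bool) :
    Store.size (Function.update σ r l) + (σ r).length = Store.size σ + l.length := by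
  have hmem : r ∈ Finset.range 7 := Finset.mem_range.2 hr
  unfold Store.size
  rw [← Finset.add_sum_erase _ _ hmem, ← Finset.add_sum_erase _ (fun r => (σ r).length) hmem,
    Finset.sum_congr rfl (g := fun r => (σ r).length) fun k hk => by
      rw [Function.update_of_ne (Finset.ne_of_mem_erase hk)]]
  simp only [Function.update_self]
  omega

lemma Store.length_le_size (σ : Store) {r : ℕ} (hr : r < 7) : (σ r).length ≤ Store.size σ :=
  Finset.single_le_sum (f := fun r => (σ r).length) (fun _ _ => Nat.zero_le _)
    (Finset.mem_range.2 hr)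

lemma Polynomial.eval_mono_nat (p : Polynomial ℕ) {m n : ℕ} (h : m ≤ n) :
    p.eval m ≤ p.eval n := by
  rw [Polynomial.eval_eq_sum_range, Polynomial.eval_eq_sum_range]
  gcongr

namespace OracleProg

variable {A : Language Bool}

/-- The program always halts, in polynomial time, touches only the working stacks, and leaves there
at most `k` bits more than before. -/
def GrowsBy (A : Language Bool) (c : OracleProg) (k : ℕ) : Prop :=
  ∃ p : Polynomial ℕ, ∀ σ : Store, ∃ t τ, c.Runs A σ t τ ∧ t ≤ p.eval (Store.size σ) ∧
    Store.size τ ≤ Store.size σ + k ∧ ∀ r ≥ 7, τ r = σ r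

/-- The program always halts, in polynomial time, touches only the working stacks, and leaves there
at most polynomially many bits. -/
def PolyBounded (A : Language Bool) (c : OracleProg) : Prop :=
  ∃ p : Polynomial ℕ, ∀ σ : Store, ∃ t τ, c.Runs A σ t τ ∧ t ≤ p.eval (Store.size σ) ∧
    Store.size τ ≤ p.eval (Store.size σ) ∧ ∀ r ≥ 7, τ r = σ r

lemma GrowsBy.mono {c : OracleProg} {k k' : ℕ} (h : GrowsBy A c k) (hk : k ≤ k') :
    GrowsBy A c k' := by
  obtain ⟨p, hp⟩ := h
  refine ⟨p, fun σ => ?_⟩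
  obtain ⟨t, τ, h1, h2, h3, h4⟩ := hp σ
  exact ⟨t, τ, h1, h2, by omega, h4⟩

lemma GrowsBy.polyBounded {c : OracleProg} {k : ℕ} (h : GrowsBy A c k) : PolyBounded A c := by
  obtain ⟨p, hp⟩ := h
  refine ⟨p + Polynomial.X + Polynomial.C k, fun σ => ?_⟩
  obtain ⟨t, τ, h1, h2, h3, h4⟩ := hp σ
  refine ⟨t, τ, h1, ?_, ?_, h4⟩ <;>
    simp only [Polynomial.eval_add, Polynomial.eval_X, Polynomial.eval_C] <;> omega

lemma growsBy_skip (k : ℕ) : GrowsBy A .skip k :=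
  ⟨1, fun σ => ⟨1, σ, .skip σ, by simp, by omega, fun _ _ => rfl⟩⟩

lemma growsBy_push {r : ℕ} (hr : r < 7) (b : Bool) : GrowsBy A (.push r b) 1 := by
  refine ⟨1, fun σ => ⟨1, _, .push r b σ, by simp, ?_, fun q hq => ?_⟩⟩
  · have := Store.size_update σ hr (b :: σ r)
    simp only [List.length_cons] at this
    omega
  · rw [Function.update_of_ne (by omega)]

lemma GrowsBy.seq {c₁ c₂ : OracleProg} {k₁ k₂ : ℕ} (h₁ : GrowsBy A c₁ k₁)
    (h₂ : GrowsBy A c₂ k₂) : GrowsBy A (.seq c₁ c₂) (k₁ + k₂) := by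
  obtain ⟨p₁, hp₁⟩ := h₁
  obtain ⟨p₂, hp₂⟩ := h₂
  refine ⟨p₁ + p₂.comp (Polynomial.X + Polynomial.C k₁), fun σ => ?_⟩
  obtain ⟨t, τ, h1, h2, h3, h4⟩ := hp₁ σ
  obtain ⟨t', τ', h1', h2', h3', h4'⟩ := hp₂ τ
  refine ⟨t + t', τ', .seq h1 h1', ?_, by omega, fun r hr => (h4' r hr).trans (h4 r hr)⟩
  have := p₂.eval_mono_nat h3
  simp only [Polynomial.eval_add, Polynomial.eval_comp, Polynomial.eval_X, Polynomial.eval_C]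
  omega

lemma PolyBounded.seq {c₁ c₂ : OracleProg} (h₁ : PolyBounded A c₁) (h₂ : PolyBounded A c₂) :
    PolyBounded A (.seq c₁ c₂) := by
  obtain ⟨p₁, hp₁⟩ := h₁
  obtain ⟨p₂, hp₂⟩ := h₂
  refine ⟨p₁ + p₂.comp p₁, fun σ => ?_⟩
  obtain ⟨t, τ, h1, h2, h3, h4⟩ := hp₁ σ
  obtain ⟨t', τ', h1', h2', h3', h4'⟩ := hp₂ τ
  have := p₂.eval_mono_nat h3
  refine ⟨t + t', τ', .seq h1 h1', ?_, ?_, fun r hr => (h4' r hr).trans (h4 r hr)⟩ <;>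
    simp only [Polynomial.eval_add, Polynomial.eval_comp] <;> omega

/-- The removed bit is a credit that the continuation may spend. This bookkeeping is what shows that
the loops terminate. -/
lemma GrowsBy.onTop {r k : ℕ} (hr : r < 7) {cE : OracleProg} {c : Bool → OracleProg}
    (hE : GrowsBy A cE k) (h : ∀ b, GrowsBy A (c b) (k + 1)) : GrowsBy A (onTop r cE c) k := by
  obtain ⟨p, hp⟩ := hE
  choose q hq using h
  refine ⟨p + q false + q true + 1, fun σ => ?_⟩
  simp only [Polynomial.eval_add, Polynomial.eval_one]
  cases hσ : σ r with
  | nil =>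
    obtain ⟨t, τ, h1, h2, h3, h4⟩ := hp σ
    exact ⟨t + 1, τ, .onTop_nil hσ h1, by omega, h3, h4⟩
  | cons b l =>
    obtain ⟨t, τ, h1, h2, h3, h4⟩ := hq b (Function.update σ r l)
    have hs := Store.size_update σ hr l
    rw [hσ, List.length_cons] at hs
    have hm := (q b).eval_mono_nat
      (show Store.size (Function.update σ r l) ≤ Store.size σ by omega)
    refine ⟨t + 1, τ, .onTop_cons hσ h1, ?_, by omega, fun s hs => ?_⟩
    · cases b <;> omega
    · rw [h4 s hs, Function.update_of_ne (by omega)]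

lemma GrowsBy.query {r k : ℕ} {cY cN : OracleProg} (hY : GrowsBy A cY k) (hN : GrowsBy A cN k) :
    GrowsBy A (.query r cY cN) k := by
  obtain ⟨p, hp⟩ := hY
  obtain ⟨q, hq⟩ := hN
  refine ⟨p + q + 1, fun σ => ?_⟩
  simp only [Polynomial.eval_add, Polynomial.eval_one]
  by_cases hσ : σ r ∈ A
  · obtain ⟨t, τ, h1, h2, h3, h4⟩ := hp σ
    exact ⟨t + 1, τ, .queryYes hσ h1, by omega, h3, h4⟩
  · obtain ⟨t, τ, h1, h2, h3, h4⟩ := hq σ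
    exact ⟨t + 1, τ, .queryNo hσ h1, by omega, h3, h4⟩

/-- A loop that removes a bit in every round, and puts back no more bits than that round has
removed before. -/
lemma GrowsBy.loop {r : ℕ} (hr : r < 7) {cE : OracleProg} {c : Bool → OracleProg}
    (h : ∀ b, GrowsBy A (c b) 0) : GrowsBy A (.loop r (OracleProg.onTop r cE c)) 0 := by
  choose q hq using h
  -- Every round shrinks the total size, so the loop test is made at most size + 1 times; the
  -- summand `2` covers the removal of a bit and the test.
  refine ⟨(Polynomial.X + 1) * (q false + q true + 2), fun σ => ?_⟩
  simp only [Polynomial.eval_add, Polynomial.eval_one, Polynomial.eval_mul, Polynomial.eval_X,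
    Polynomial.eval_ofNat]
  induction hn : Store.size σ using Nat.strong_induction_on generalizing σ with
  | _ n ih =>
    cases hσ : σ r with
    | nil => exact ⟨1, σ, .loopDone hσ, by nlinarith, by omega, fun _ _ => rfl⟩
    | cons b l =>
      obtain ⟨t, τ, h1, h2, h3, h4⟩ := hq b (Function.update σ r l)
      have hs := Store.size_update σ hr l
      rw [hσ, List.length_cons] at hs
      obtain ⟨t', τ', h1', h2', h3', h4'⟩ := ih (Store.size τ) (by omega) τ rfl
      have hτ : Store.size τ + 1 ≤ n := by omega
      have hm := (q b).eval_mono_nat (show Store.size (Function.update σ r l) ≤ n by omega)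
      have hf := (q false).eval_mono_nat (show Store.size τ ≤ n by omega)
      have ht := (q true).eval_mono_nat (show Store.size τ ≤ n by omega)
      refine ⟨_, τ', .loopStep (by simp [hσ]) (.onTop_cons hσ h1) h1', ?_, by omega,
        fun s hs => ?_⟩
      · have hb : (q b).eval n ≤ (q false).eval n + (q true).eval n := by cases b <;> omega
        calc t + 1 + t' + 1
            ≤ ((q false).eval n + (q true).eval n + 2) +
              (Store.size τ + 1) * ((q false).eval (Store.size τ) +
                (q true).eval (Store.size τ) + 2) := by omega
          _ ≤ ((q false).eval n + (q true).eval n + 2) +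
              n * ((q false).eval n + (q true).eval n + 2) := by gcongr
          _ = _ := by ring
      · rw [h4' s hs, h4 s hs, Function.update_of_ne (by omega)]

/-! ### Some short programs -/

/-- Run the programs of a list one after the other. -/
def seqAll : List OracleProg → OracleProg
  | [] => .skip
  | c :: cs => .seq c (seqAll cs)

@[simp] lemma exec_seqAll_nil {σ τ : Store} : Exec A (seqAll []) σ τ ↔ τ = σ := exec_skip

@[simp] lemma exec_seqAll_cons {c : OracleProg} {cs : List OracleProg} {σ τ : Store} :
    Exec A (seqAll (c :: cs)) σ τ ↔ ∃ σ', Exec A c σ σ' ∧ Exec A (seqAll cs) σ' τ := exec_seq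

lemma polyBounded_seqAll {cs : List OracleProg} (h : ∀ c ∈ cs, PolyBounded A c) :
    PolyBounded A (seqAll cs) := by
  induction cs with
  | nil => exact (growsBy_skip 0).polyBounded
  | cons c cs ih =>
    exact (h c (by simp)).seq (ih fun c' hc' => h c' (by simp [hc']))

/-- Put a list on top of stack `r`. -/
def pushAll (r : ℕ) : List Bool → OracleProg
  | [] => .skip
  | b :: l => .seq (pushAll r l) (.push r b)

lemma runs_pushAll (r : ℕ) (l : List Bool) (σ : Store) :
    (pushAll r l).Runs A σ (l.length + 1) (Function.update σ r (l ++ σ r)) := by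
  induction l with
  | nil => exact (Runs.skip σ).congr rfl (by simp)
  | cons b l ih =>
    have := Runs.push (A := A) r b (Function.update σ r (l ++ σ r))
    simp only [Function.update_self, Function.update_idem] at this
    exact ih.seq this

@[simp] lemma exec_pushAll {r : ℕ} {l : List Bool} {σ τ : Store} :
    Exec A (pushAll r l) σ τ ↔ τ = Function.update σ r (l ++ σ r) :=
  Exec.iff_eq ⟨_, runs_pushAll r l σ⟩

lemma growsBy_pushAll {r : ℕ} (hr : r < 7) (l : List Bool) :
    GrowsBy A (pushAll r l) l.length := by
  induction l with
  | nil => exact growsBy_skip 0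
  | cons b l ih => exact ih.seq (growsBy_push hr b)

/-- Move the contents of stack `r` to stack `s`, and, for every moved bit `b`, put `w b` on stack
`q`. -/
def copy (r s q : ℕ) (w : Bool → List Bool) : OracleProg :=
  .loop r (onTop r .skip fun b => .seq (.push s b) (pushAll q (w b)))

lemma runs_copy {r s q : ℕ} (hrs : r ≠ s) (hrq : r ≠ q) (hsq : s ≠ q) {w : Bool → List Bool}
    {m : ℕ} (hw : ∀ b, (w b).length = m) (σ : Store) :
    (copy r s q w).Runs A σ ((m + 4) * (σ r).length + 1)
      (Function.update (Function.update (Function.update σ s ((σ r).reverse ++ σ s)) q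
        ((σ r).reverse.flatMap w ++ σ q)) r []) := by
  induction hl : σ r generalizing σ with
  | nil =>
    refine (Runs.loopDone hl).congr (by simp) (funext fun k => ?_)
    simp only [Function.update_apply]
    split_ifs <;> simp_all
  | cons b l ih =>
    have h1 : (onTop r .skip fun b => .seq (.push s b) (pushAll q (w b))).Runs A σ
        (1 + ((w b).length + 1) + 1) _ :=
      .onTop_cons hl (.seq (.push s b _) (runs_pushAll q (w b) _))
    have h2 := h1.loopStep (by simp [hl]) (ih _ (by
      simp [Function.update_apply, hrs, hrq]))
    refine h2.congr ?_ (funext fun k => ?_)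
    · rw [hw, List.length_cons]; ring
    · simp only [Function.update_apply]
      split_ifs <;> simp_all

lemma exec_copy {r s q : ℕ} (hrs : r ≠ s) (hrq : r ≠ q) (hsq : s ≠ q) {w : Bool → List Bool}
    {m : ℕ} (hw : ∀ b, (w b).length = m) {σ τ : Store} :
    Exec A (copy r s q w) σ τ ↔
      τ = Function.update (Function.update (Function.update σ s ((σ r).reverse ++ σ s)) q
        ((σ r).reverse.flatMap w ++ σ q)) r [] :=
  Exec.iff_eq ⟨_, runs_copy hrs hrq hsq hw σ⟩

lemma polyBounded_copy {r s q : ℕ} (hr : r < 7) (hs : s < 7) (hq : q < 7) (hrs : r ≠ s)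
    (hrq : r ≠ q) (hsq : s ≠ q) {w : Bool → List Bool} {m : ℕ} (hw : ∀ b, (w b).length = m) :
    PolyBounded A (copy r s q w) := by
  refine ⟨Polynomial.C (m + 4) * Polynomial.X + 1, fun σ =>
    ⟨_, _, runs_copy hrs hrq hsq hw σ, ?_, ?_, fun k hk => ?_⟩⟩
  · simp only [Polynomial.eval_add, Polynomial.eval_mul, Polynomial.eval_C, Polynomial.eval_X,
      Polynomial.eval_one]
    have := Store.length_le_size σ hr
    gcongr
  · set σ₁ := Function.update σ s ((σ r).reverse ++ σ s) with hσ₁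
    set σ₂ := Function.update σ₁ q ((σ r).reverse.flatMap w ++ σ q) with hσ₂
    have h1 := Store.size_update σ hs ((σ r).reverse ++ σ s)
    have h2 := Store.size_update σ₁ hq ((σ r).reverse.flatMap w ++ σ q)
    have h3 := Store.size_update σ₂ hr []
    have e1 : σ₁ q = σ q := Function.update_of_ne hsq.symm _ _
    have hlen : ((σ r).reverse.flatMap w).length = m * (σ r).length := by
      simp [List.length_flatMap, hw, mul_comm]
    rw [← hσ₁] at h1
    rw [← hσ₂, e1] at h2
    simp only [List.length_append, List.length_reverse, List.length_nil, hlen] at h1 h2 h3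
    simp only [Polynomial.eval_add, Polynomial.eval_mul, Polynomial.eval_C, Polynomial.eval_X,
      Polynomial.eval_one]
    have := Store.length_le_size σ hr
    nlinarith
  · rw [Function.update_of_ne (by omega), Function.update_of_ne (by omega),
      Function.update_of_ne (by omega)]

/-- Move the contents of stack `r` to stack `s`. -/
def move (r s : ℕ) : OracleProg := .loop r (onTop r .skip fun b => .push s b)

lemma runs_move {r s : ℕ} (hrs : r ≠ s) (σ : Store) :
    (move r s).Runs A σ (3 * (σ r).length + 1)
      (Function.update (Function.update σ s ((σ r).reverse ++ σ s)) r []) := by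
  induction hl : σ r generalizing σ with
  | nil =>
    refine (Runs.loopDone hl).congr (by simp) (funext fun k => ?_)
    simp only [Function.update_apply]
    split_ifs <;> simp_all
  | cons b l ih =>
    have h1 : (onTop r .skip fun b => .push s b).Runs A σ (1 + 1) _ :=
      .onTop_cons hl (.push s b _)
    have h2 := h1.loopStep (by simp [hl]) (ih _ (by simp [Function.update_apply, hrs]))
    refine h2.congr ?_ (funext fun k => ?_)
    · rw [List.length_cons]; ring
    · simp only [Function.update_apply]
      split_ifs <;> simp_all

lemma exec_move {r s : ℕ} (hrs : r ≠ s) {σ τ : Store} :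
    Exec A (move r s) σ τ ↔
      τ = Function.update (Function.update σ s ((σ r).reverse ++ σ s)) r [] :=
  Exec.iff_eq ⟨_, runs_move hrs σ⟩

lemma growsBy_move {r s : ℕ} (hr : r < 7) (hs : s < 7) (hrs : r ≠ s) :
    GrowsBy A (move r s) 0 := by
  refine ⟨3 * Polynomial.X + 1, fun σ => ⟨_, _, runs_move hrs σ, ?_, ?_, fun k hk => ?_⟩⟩
  · simp only [Polynomial.eval_add, Polynomial.eval_mul, Polynomial.eval_ofNat, Polynomial.eval_X,
      Polynomial.eval_one]
    have := Store.length_le_size σ hr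
    omega
  · set σ₁ := Function.update σ s ((σ r).reverse ++ σ s) with hσ₁
    have h1 := Store.size_update σ hs ((σ r).reverse ++ σ s)
    have h2 := Store.size_update σ₁ hr []
    have e1 : σ₁ r = σ r := Function.update_of_ne hrs _ _
    rw [← hσ₁] at h1
    rw [e1] at h2
    simp only [List.length_append, List.length_reverse, List.length_nil] at h1 h2
    omega
  · rw [Function.update_of_ne (by omega), Function.update_of_ne (by omega)]

end OracleProg

/-! ### Decoding pairs and evaluating circuits -/

namespace OracleProg

variable {A : Language Bool}

/-- Take a pair `pairBits q u` from stack `r`: leave `u` there and put the bits of `q` on stack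
`s`. -/
def unpair (r s : ℕ) : OracleProg :=
  .seq (.push 4 true) (.loop 4 (onTop 4 .skip fun _ => onTop r .skip fun more =>
    if more then onTop r .skip fun b => .seq (.push s b) (.push 4 true) else .skip))

lemma growsBy_unpair {r s : ℕ} (hr : r < 7) (hs : s < 7) : GrowsBy A (unpair r s) 1 := by
  refine GrowsBy.seq (k₂ := 0) (growsBy_push (by omega) _) (GrowsBy.loop (by omega) fun _ =>
    GrowsBy.onTop hr (growsBy_skip _) fun more => ?_)
  cases more
  · exact growsBy_skip _
  · exact GrowsBy.onTop hr (growsBy_skip _) fun b =>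
      GrowsBy.mono ((growsBy_push hs b).seq (growsBy_push (by omega) true)) (by omega)

/-- Stack `4` holds the flag that keeps the loop alive: it is consumed in each round and renewed
only after a bit of `q` was read. Pushing these bits reverses them. -/
lemma exec_unpair_loop {r s : ℕ} (hr : r ≠ 4) (hs : s ≠ 4) (hrs : r ≠ s) (q u : List Bool)
    (σ : Store) (h4 : σ 4 = [true]) (hσ : σ r = pairBits q u) :
    Exec A (.loop 4 (onTop 4 .skip fun _ => onTop r .skip fun more =>
      if more then onTop r .skip fun b => .seq (.push s b) (.push 4 true) else .skip)) σ
      (Function.update (Function.update (Function.update σ 4 []) r u) s (q.reverse ++ σ s)) := by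
  induction q generalizing σ with
  | nil =>
    rw [exec_loop_ne_nil (by simp [h4])]
    have hσ' : σ r = false :: u := hσ
    refine ⟨Function.update (Function.update σ 4 []) r u, ?_, ?_⟩
    · simp [h4, hr, hσ']
    · rw [exec_loop_nil (by simp [hr.symm])]
      funext k
      simp only [Function.update_apply]
      split_ifs <;> simp_all
  | cons b q ih =>
    rw [exec_loop_ne_nil (by simp [h4])]
    have hσ' : σ r = true :: b :: pairBits q u := hσ
    refine ⟨Function.update (Function.update (Function.update σ r (pairBits q u)) s (b :: σ s)) 4
      [true], ?_, ?_⟩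
    · simp only [exec_onTop, h4, topCases_cons, Function.update_of_ne hr, hσ', if_true,
        Function.update_self, exec_seq, exec_push, exists_eq_left]
      funext k
      simp only [Function.update_apply]
      split_ifs <;> simp_all
    · convert ih (Function.update (Function.update (Function.update σ r (pairBits q u)) s
        (b :: σ s)) 4 [true]) (by simp) (by simp [hr, hrs]) using 1
      funext k
      simp only [Function.update_apply]
      split_ifs <;> simp_all

lemma exec_unpair {r s : ℕ} (hr : r ≠ 4) (hs : s ≠ 4) (hrs : r ≠ s) {q u : List Bool}
    {σ : Store} (h4 : σ 4 = []) (hσ : σ r = pairBits q u) {τ : Store} :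
    Exec A (unpair r s) σ τ ↔
      τ = Function.update (Function.update σ r u) s (q.reverse ++ σ s) := by
  refine Exec.iff_eq ?_
  rw [unpair, exec_seq]
  refine ⟨_, exec_push.2 rfl, ?_⟩
  convert exec_unpair_loop hr hs hrs q u (Function.update σ 4 (true :: σ 4)) (by simp [h4])
    (by simpa [hr] using hσ) using 1
  funext k
  simp only [Function.update_apply]
  split_ifs <;> simp_all

/-- Read a number in unary from stack `2`, and move as many bits from stack `5` to stack `1`.  If
there are too few bits, leave a bit on stack `5` as a mark. -/
def seek : OracleProg :=
  .seq (.push 4 true) (.loop 4 (onTop 4 .skip fun _ => onTop 2 .skip fun more =>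
    if more then onTop 5 (.push 5 true) fun v => .seq (.push 1 v) (.push 4 true) else .skip))

lemma growsBy_seek : GrowsBy A seek 1 := by
  refine GrowsBy.seq (k₂ := 0) (growsBy_push (by omega) _) (GrowsBy.loop (by omega) fun _ =>
    GrowsBy.onTop (by omega) (growsBy_skip _) fun more => ?_)
  cases more
  · exact growsBy_skip _
  · exact GrowsBy.onTop (by omega) (growsBy_push (by omega) true) fun b =>
      GrowsBy.mono ((growsBy_push (by omega) b).seq (growsBy_push (by omega) true)) (by omega)

lemma unaryBits_succ_append (i : ℕ) (rest : List Bool) :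
    unaryBits (i + 1) ++ rest = true :: (unaryBits i ++ rest) := by
  simp [unaryBits, List.replicate_succ]

lemma exec_seek {i : ℕ} {a₀ y rest a₃ vals a₆ : List Bool} {ρ τ : Store}
    (hi : i ≤ vals.length) :
    Exec A seek (mkStore a₀ y (unaryBits i ++ rest) a₃ [] vals a₆ ρ) τ ↔
      τ = mkStore a₀ ((vals.take i).reverse ++ y) rest a₃ [] (vals.drop i) a₆ ρ := by
  refine Exec.iff_eq ?_
  rw [seek, exec_seq]
  refine ⟨_, exec_push.2 rfl, ?_⟩
  simp only [mkStore_four, update_mkStore_four]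
  induction i generalizing y vals with
  | zero =>
    rw [exec_loop_ne_nil (by simp)]
    refine ⟨mkStore a₀ y rest a₃ [] vals a₆ ρ, by simp [unaryBits], ?_⟩
    rw [exec_loop_nil (by simp)]
    simp
  | succ i ih =>
    cases vals with
    | nil => simp at hi
    | cons v vals =>
      rw [exec_loop_ne_nil (by simp), unaryBits_succ_append]
      refine ⟨mkStore a₀ (v :: y) (unaryBits i ++ rest) a₃ [true] vals a₆ ρ, by simp, ?_⟩
      convert ih (y := v :: y) (vals := vals) (by simpa using hi) using 1
      simp

/-- The mark distinguishes a list that is too short from one of exactly the right length: only the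
latter leaves stack `5` empty. -/
lemma exec_seek_fail {i : ℕ} {a₀ y rest a₃ vals a₆ : List Bool} {ρ : Store}
    (hi : vals.length < i) :
    ∃ y' rest', Exec A seek (mkStore a₀ y (unaryBits i ++ rest) a₃ [] vals a₆ ρ)
      (mkStore a₀ y' rest' a₃ [] [true] a₆ ρ) := by
  simp only [seek, exec_seq, exec_push, exists_eq_left, mkStore_four, update_mkStore_four]
  induction vals generalizing y i with
  | nil =>
    obtain ⟨i, rfl⟩ : ∃ j, i = j + 1 := ⟨i - 1, by simp at hi; omega⟩
    refine ⟨y, unaryBits i ++ rest, ?_⟩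
    rw [exec_loop_ne_nil (by simp), unaryBits_succ_append]
    refine ⟨_, by simp; rfl, ?_⟩
    rw [exec_loop_nil (by simp)]
  | cons v vals ih =>
    obtain ⟨i, rfl⟩ : ∃ j, i = j + 1 := ⟨i - 1, by simp at hi; omega⟩
    obtain ⟨y', rest', h⟩ := ih (y := v :: y) (i := i) (by simpa using hi)
    refine ⟨y', rest', ?_⟩
    rw [exec_loop_ne_nil (by simp), unaryBits_succ_append]
    exact ⟨mkStore a₀ (v :: y) (unaryBits i ++ rest) a₃ [true] vals a₆ ρ, by simp, h⟩

/-- Read the number `i` of a wire from stack `2` and run `k v` for the value `v` of the wire; the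
values of the wires are on stack `5`. -/
def lookup (k : Bool → OracleProg) : OracleProg :=
  .seq seek (onTop 5 .skip fun v => .seq (.push 5 v) (.seq (move 1 5) (k v)))

lemma growsBy_lookup {k : Bool → OracleProg} {m : ℕ} (h : ∀ v, GrowsBy A (k v) m) :
    GrowsBy A (lookup k) (1 + m) :=
  growsBy_seek.seq (GrowsBy.onTop (by omega) (growsBy_skip _) fun v =>
    ((growsBy_push (by omega) v).seq ((growsBy_move (by omega) (by omega) (by omega)).seq
      (h v))).mono (by omega))

/-- The earlier values are parked on stack `1`, in reverse, while the wanted one is read; moving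
them back restores the list, so reading is not destructive. -/
lemma exec_lookup {k : Bool → OracleProg} {i : ℕ} {a₀ rest a₃ vals a₆ : List Bool} {ρ τ : Store}
    (hi : i < vals.length) :
    Exec A (lookup k) (mkStore a₀ [] (unaryBits i ++ rest) a₃ [] vals a₆ ρ) τ ↔
      Exec A (k (vals.getD i false)) (mkStore a₀ [] rest a₃ [] vals a₆ ρ) τ := by
  have h := List.take_append_drop i vals
  rw [List.drop_eq_getElem_cons hi] at h
  simp only [lookup, exec_seq, exec_seek hi.le, exists_eq_left, exec_onTop, mkStore_five,
    List.drop_eq_getElem_cons hi, topCases_cons, exec_push, update_mkStore_five,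
    exec_move (show (1 : ℕ) ≠ 5 by omega), mkStore_one, update_mkStore_one, List.append_nil,
    List.reverse_reverse, h, List.getD_eq_getElem _ _ hi]

/-- Append the value of a new wire, and continue. -/
def append (v : Bool) : OracleProg :=
  .seq (move 5 1) (.seq (.push 5 v) (.seq (move 1 5) (.push 4 true)))

lemma growsBy_append (v : Bool) : GrowsBy A (append v) 2 :=
  ((growsBy_move (by omega) (by omega) (by omega)).seq ((growsBy_push (by omega) v).seq
    ((growsBy_move (by omega) (by omega) (by omega)).seq (growsBy_push (by omega) true)))).mono
      (by omega)

@[simp] lemma exec_append {v : Bool} {a₀ e a₃ vals a₆ : List Bool} {ρ τ : Store} :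
    Exec A (append v) (mkStore a₀ [] e a₃ [] vals a₆ ρ) τ ↔
      τ = mkStore a₀ [] e a₃ [true] (vals ++ [v]) a₆ ρ := by
  simp [append, exec_move]

/-- Evaluate the next gate. -/
def gateStep : OracleProg :=
  onTop 2 .skip fun more => if more then
    onTop 2 .skip fun bin => if bin then
      onTop 2 .skip fun a => onTop 2 .skip fun b => onTop 2 .skip fun c => onTop 2 .skip fun d =>
        lookup fun u => lookup fun v =>
          append (if u then (if v then d else c) else (if v then b else a))
    else onTop 2 .skip fun un => if un then
      onTop 2 .skip fun a => onTop 2 .skip fun b => lookup fun u => append (if u then b else a)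
    else onTop 2 .skip fun b => append b
  else .skip

/-- The bits consumed from the description of a gate pay for the new wire, the loop flag and the
possible marks left by lookups. -/
lemma growsBy_gateStep : GrowsBy A gateStep 0 := by
  have h2 : 2 < 7 := by omega
  refine .onTop h2 (growsBy_skip _) fun more => ?_
  cases more
  · exact growsBy_skip _
  rw [if_pos rfl]
  refine .onTop h2 (growsBy_skip _) fun bin => ?_
  cases bin
  · rw [if_neg Bool.false_ne_true]
    refine .onTop h2 (growsBy_skip _) fun un => ?_
    cases un
    · exact .onTop h2 (growsBy_skip _) fun b => (growsBy_append b).mono (by omega)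
    · rw [if_pos rfl]
      refine .onTop h2 (growsBy_skip _) fun a => .onTop h2 (growsBy_skip _) fun b => ?_
      exact (growsBy_lookup fun u => growsBy_append _).mono (by omega)
  · rw [if_pos rfl]
    exact .onTop h2 (growsBy_skip _) fun a => .onTop h2 (growsBy_skip _) fun b =>
      .onTop h2 (growsBy_skip _) fun c => .onTop h2 (growsBy_skip _) fun d =>
        (growsBy_lookup fun u => growsBy_lookup fun v => growsBy_append _).mono (by omega)

lemma exec_gateStep {g : B2Gate} {a₀ e a₃ vals a₆ : List Bool} {ρ τ : Store}
    (hg : g.ReadsBelow vals.length) :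
    Exec A gateStep (mkStore a₀ [] (true :: (g.encode ++ e)) a₃ [] vals a₆ ρ) τ ↔
      τ = mkStore a₀ [] e a₃ [true] (vals ++ [g.eval vals]) a₆ ρ := by
  cases g with
  | const b => simp [gateStep, B2Gate.encode, B2Gate.eval]
  | unary op i =>
    have hi : i < vals.length := hg
    simp only [gateStep, B2Gate.encode, B2Gate.eval, exec_onTop, mkStore_two, topCases_cons,
      update_mkStore_two, if_true, List.cons_append, List.nil_append, Bool.false_eq_true, if_false,
      exec_lookup hi, exec_append]
    cases vals.getD i false <;> simp
  | binary op i j =>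
    obtain ⟨hi, hj⟩ : i < vals.length ∧ j < vals.length := hg
    simp only [gateStep, B2Gate.encode, B2Gate.eval, exec_onTop, mkStore_two, topCases_cons,
      update_mkStore_two, if_true, List.cons_append, List.nil_append, List.append_assoc,
      exec_lookup hi, exec_lookup hj, exec_append]
    cases vals.getD i false <;> cases vals.getD j false <;> simp

/-- Evaluate all gates, and put the value of the output wire on stack `3`. -/
def evalGates : OracleProg :=
  .seq (.push 4 true) (.seq (.loop 4 (onTop 4 .skip fun _ => gateStep))
    (lookup fun v => .push 3 v))

lemma growsBy_evalGates : GrowsBy A evalGates 3 :=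
  (growsBy_push (by omega) _).seq ((GrowsBy.loop (by omega) fun _ => growsBy_gateStep).seq
    (growsBy_lookup fun v => growsBy_push (by omega) v)) |>.mono (by omega)

lemma exec_evalGates {gates : List B2Gate} {o : ℕ} {a₀ a₃ vals a₆ : List Bool} {ρ τ : Store}
    (hgates : ∀ (k : ℕ) (hk : k < gates.length), (gates[k]).ReadsBelow (vals.length + k))
    (ho : o < vals.length + gates.length) :
    Exec A evalGates (mkStore a₀ []
        (gates.flatMap (fun g => true :: g.encode) ++ false :: unaryBits o) a₃ [] vals a₆ ρ) τ ↔
      τ = mkStore a₀ [] [] ((wireValues gates vals).getD o false :: a₃) []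
        (wireValues gates vals) a₆ ρ := by
  have hloop : ∀ rest, Exec A (.loop 4 (onTop 4 .skip fun _ => gateStep))
      (mkStore a₀ [] (gates.flatMap (fun g => true :: g.encode) ++ false :: rest) a₃ [true] vals
        a₆ ρ) (mkStore a₀ [] rest a₃ [] (wireValues gates vals) a₆ ρ) := by
    intro rest
    clear ho
    induction gates generalizing vals with
    | nil =>
      rw [exec_loop_ne_nil (by simp)]
      refine ⟨mkStore a₀ [] rest a₃ [] vals a₆ ρ, by simp [gateStep], ?_⟩
      rw [exec_loop_nil (by simp), wireValues_nil]
    | cons g gates ih =>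
      rw [exec_loop_ne_nil (by simp)]
      refine ⟨mkStore a₀ [] (gates.flatMap (fun g => true :: g.encode) ++ false :: rest) a₃ [true]
        (vals ++ [g.eval vals]) a₆ ρ, ?_, ?_⟩
      · simp only [exec_onTop, mkStore_four, topCases_cons, update_mkStore_four,
          List.flatMap_cons, List.cons_append, List.append_assoc]
        rw [exec_gateStep (g := g) (hgates 0 (by simp))]
      · refine ih fun k hk => ?_
        have h := hgates (k + 1) (by simpa using hk)
        rw [List.getElem_cons_succ] at h
        rw [List.length_append, List.length_singleton]
        convert h using 1
        omega
  refine Exec.iff_eq ?_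
  rw [evalGates, exec_seq]
  refine ⟨_, exec_push.2 rfl, ?_⟩
  rw [exec_seq, mkStore_four, update_mkStore_four]
  refine ⟨_, hloop _, ?_⟩
  have := exec_lookup (A := A) (k := fun v => .push 3 v) (i := o) (a₀ := a₀) (rest := [])
    (a₃ := a₃) (vals := wireValues gates vals) (a₆ := a₆) (ρ := ρ)
    (τ := mkStore a₀ [] [] ((wireValues gates vals).getD o false :: a₃) []
        (wireValues gates vals) a₆ ρ) (by simpa using ho)
  rw [List.append_nil] at this
  rw [this]
  simp

/-! ### The verifier -/

/-- On input `pairBits (pairBits q e) u`, where `e` encodes a circuit with `n` inputs: put the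
string `x = q.reverse ++ u`, reversed, on stack `6`, and, if its length is `n`, the value of the
circuit on stack `3`. -/
def evalPrefix : OracleProg :=
  seqAll [unpair 0 1, move 1 2, unpair 2 1, move 1 3, move 3 0, copy 0 1 6 fun b => [b],
    move 1 5, seek, onTop 5 (.seq (move 1 5) evalGates) fun _ => .skip]

lemma polyBounded_evalPrefix : PolyBounded A evalPrefix := by
  refine polyBounded_seqAll fun c hc => ?_
  simp only [List.mem_cons, List.not_mem_nil, or_false] at hc
  rcases hc with rfl | rfl | rfl | rfl | rfl | rfl | rfl | rfl | rfl
  · exact (growsBy_unpair (by omega) (by omega)).polyBounded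
  · exact (growsBy_move (by omega) (by omega) (by omega)).polyBounded
  · exact (growsBy_unpair (by omega) (by omega)).polyBounded
  · exact (growsBy_move (by omega) (by omega) (by omega)).polyBounded
  · exact (growsBy_move (by omega) (by omega) (by omega)).polyBounded
  · exact polyBounded_copy (by omega) (by omega) (by omega) (by omega) (by omega) (by omega)
      (m := 1) fun _ => rfl
  · exact (growsBy_move (by omega) (by omega) (by omega)).polyBounded
  · exact growsBy_seek.polyBounded
  · exact (GrowsBy.onTop (by omega)
      ((growsBy_move (by omega) (by omega) (by omega)).seq growsBy_evalGates)
      fun _ => growsBy_skip _).polyBounded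

/-- The value of a circuit on a list of bits. -/
def _root_.B2Circuit.evalList {n : ℕ} (C : B2Circuit n) (x : List Bool) : Bool :=
  (wireValues C.gates x).getD C.out false

/-- After `seek` has taken n bits of the candidate, stack `5` is empty exactly when the length is n,
and only then is the circuit evaluated. An empty stack `3` thus signals a wrong length. -/
lemma exec_evalPrefix {n : ℕ} (C : B2Circuit n) (q u : List Bool) (ρ : Store) :
    ∃ a₀ a₁ a₂ a₄ a₅, Exec A evalPrefix
      (mkStore (pairBits (pairBits q C.encode) u) [] [] [] [] [] [] ρ)
      (mkStore a₀ a₁ a₂ (if (q.reverse ++ u).length = n then [C.evalList (q.reverse ++ u)] else [])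
        a₄ a₅ (q.reverse ++ u).reverse ρ) := by
  set rest := C.gates.flatMap (fun g => true :: g.encode) ++ false :: unaryBits C.out with hrest
  have henc : C.encode = unaryBits n ++ rest := by
    rw [hrest, B2Circuit.encode, List.append_assoc]
  have h1 : ∀ τ, Exec A evalPrefix
      (mkStore (pairBits (pairBits q C.encode) u) [] [] [] [] [] [] ρ) τ ↔
      ∃ σ', Exec A seek (mkStore [] [] (unaryBits n ++ rest) [] [] (q.reverse ++ u)
        (q.reverse ++ u).reverse ρ) σ' ∧
        Exec A (onTop 5 (.seq (move 1 5) evalGates) fun _ => .skip) σ' τ := by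
    intro τ
    have h01 := fun τ => exec_unpair (A := A) (r := 0) (s := 1) (q := pairBits q C.encode) (u := u)
      (σ := mkStore (pairBits (pairBits q C.encode) u) [] [] [] [] [] [] ρ) (τ := τ) (by omega)
      (by omega) (by omega) rfl rfl
    have h21 := fun τ => exec_unpair (A := A) (r := 2) (s := 1) (q := q) (u := C.encode)
      (σ := mkStore u [] (pairBits q C.encode) [] [] [] [] ρ) (τ := τ) (by omega)
      (by omega) (by omega) rfl rfl
    simp only [evalPrefix, exec_seqAll_cons, h01, exists_eq_left,
      exec_move (show (1 : ℕ) ≠ 2 by omega), mkStore_one, update_mkStore_zero,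
      update_mkStore_one, update_mkStore_two, mkStore_two, List.append_nil, List.reverse_reverse,
      h21]
    have hcopy := fun σ τ => exec_copy (A := A) (r := 0) (s := 1) (q := 6) (w := fun b => [b])
      (m := 1) (by omega) (by omega) (by omega) (fun _ => rfl) (σ := σ) (τ := τ)
    simp [exec_move, hcopy, henc]
  simp only [h1]
  rcases lt_or_ge (q.reverse ++ u).length n with hn | hn
  · obtain ⟨y', rest', h⟩ := exec_seek_fail (A := A) (a₀ := []) (y := []) (rest := rest)
      (a₃ := []) (a₆ := (q.reverse ++ u).reverse) (ρ := ρ) hn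
    refine ⟨[], y', rest', [], [], _, h, ?_⟩
    simp [show q.length + u.length ≠ n by simpa using hn.ne]
  · simp only [exec_seek hn, exists_eq_left]
    rcases hn.eq_or_lt with hn | hn
    · subst hn
      simp only [exec_onTop, mkStore_five, List.drop_length, topCases_nil, exec_seq,
        exec_move (show (1 : ℕ) ≠ 5 by omega), mkStore_one, update_mkStore_five,
        update_mkStore_one, List.take_length, List.append_nil, List.reverse_reverse,
        exists_eq_left, if_true]
      simp only [hrest]
      exact ⟨_, _, _, _, _, (exec_evalGates C.gates_ok C.out_ok).2 rfl⟩
    · obtain ⟨b, l, hbl⟩ := List.exists_cons_of_ne_nil (l := (q.reverse ++ u).drop n)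
        (by rw [Ne, List.drop_eq_nil_iff]; omega)
      rw [hbl, if_neg hn.ne']
      simp only [exec_onTop, mkStore_five, topCases_cons, exec_skip, update_mkStore_five]
      exact ⟨_, _, _, _, _, rfl⟩

/-- Compare the bits on the stacks `3` and `7`: the output is `true` if both are there and
different. -/
def compareBits : OracleProg :=
  .seq (move 0 1) (onTop 3 (.push 0 false) fun c => onTop 7 (.push 0 false) fun b =>
    .push 0 (xor c b))

lemma runs_compareBits (σ : Store) :
    ∃ t τ b, compareBits.Runs A σ t τ ∧ t ≤ 3 * (σ 0).length + 4 ∧ τ 0 = [b] := by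
  set σ' := Function.update (Function.update σ 1 ((σ 0).reverse ++ σ 1)) 0 [] with hσ'
  have h0 : σ' 0 = [] := by simp [hσ']
  have hmove : (move 0 1).Runs A σ (3 * (σ 0).length + 1) σ' := runs_move (by omega) σ
  cases h3 : σ' 3 with
  | nil =>
    exact ⟨_, _, false, hmove.seq (.onTop_nil h3 (.push 0 false _)), by omega, by simp [h0]⟩
  | cons c l =>
    cases h7 : σ' 7 with
    | nil =>
      exact ⟨_, _, false, hmove.seq (.onTop_cons h3 (.onTop_nil (by simpa using h7)
        (.push 0 false _))), by omega, by simp [h0]⟩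
    | cons b l' =>
      exact ⟨_, _, xor c b, hmove.seq (.onTop_cons h3 (.onTop_cons (by simpa using h7)
        (.push 0 (xor c b) _))), by omega, by simp [h0]⟩

/-- The verifier: evaluate the circuit and the function computed by `c` on the same string, and
compare. -/
def verifier (c : OracleProg) : OracleProg :=
  .seq evalPrefix (.seq (move 6 7) (.seq c.shift compareBits))

lemma exec_move_six_seven (a₀ a₁ a₂ a₃ a₄ a₅ x : List Bool) :
    (move 6 7).Runs A (mkStore a₀ a₁ a₂ a₃ a₄ a₅ x fun _ => []) (3 * x.length + 1)
      (mkStore a₀ a₁ a₂ a₃ a₄ a₅ [] (initStore x.reverse)) := by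
  refine (runs_move (by omega) _).congr rfl ?_
  simp [initStore]

/-- A verifier must halt with a one-bit answer even on malformed input, so this cannot be read off
from `exec_verifier`, which covers encoded circuits only. -/
lemma exists_runs_verifier {c : OracleProg} {p : Polynomial ℕ} {F : List Bool → List Bool}
    (hc : ∀ w : List Bool, ∃ (t : ℕ) (τ : Store), t ≤ p.eval w.length ∧
      c.Runs A (initStore w) t τ ∧ τ 0 = F w) :
    ∃ P : Polynomial ℕ, ∀ w : List Bool, ∃ (t : ℕ) (τ : Store) (b : Bool), t ≤ P.eval w.length ∧
      (verifier c).Runs A (initStore w) t τ ∧ τ 0 = [b] := by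
  obtain ⟨P, hP⟩ := polyBounded_evalPrefix (A := A)
  refine ⟨P + (3 * P + 1) + (p.comp P + (3 * P + 4)), fun w => ?_⟩
  obtain ⟨t₁, τ₁, h1, h2, h3, h4⟩ := hP (initStore w)
  have hw : Store.size (initStore w) = w.length := by
    simp [Store.size, Finset.sum_range_succ, initStore]
  rw [hw] at h2 h3
  -- The stacks from `7` on are still empty, so moving stack `6` to stack `7` creates a proper
  -- initial store for the shifted program.
  have hτ₁ : τ₁ = mkStore (τ₁ 0) (τ₁ 1) (τ₁ 2) (τ₁ 3) (τ₁ 4) (τ₁ 5) (τ₁ 6) fun _ => [] := by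
    conv_lhs => rw [eq_mkStore τ₁]
    congr 1
    funext k
    rw [h4 _ (by omega), initStore, Function.update_of_ne (by omega)]
  have h5 := exec_move_six_seven (A := A) (τ₁ 0) (τ₁ 1) (τ₁ 2) (τ₁ 3) (τ₁ 4) (τ₁ 5) (τ₁ 6)
  rw [← hτ₁] at h5
  obtain ⟨t₂, ρ, h6, h7, -⟩ := hc (τ₁ 6).reverse
  have h8 := h7.shift (τ₁ 0) (τ₁ 1) (τ₁ 2) (τ₁ 3) (τ₁ 4) (τ₁ 5) []
  obtain ⟨t₃, τ₃, b, h9, h10, h11⟩ := runs_compareBits (A := A)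
    (mkStore (τ₁ 0) (τ₁ 1) (τ₁ 2) (τ₁ 3) (τ₁ 4) (τ₁ 5) [] ρ)
  refine ⟨_, τ₃, b, ?_, h1.seq (h5.seq (h8.seq h9)), h11⟩
  have l0 := Store.length_le_size τ₁ (r := 0) (by omega)
  have l6 := Store.length_le_size τ₁ (r := 6) (by omega)
  have := p.eval_mono_nat (show (τ₁ 6).reverse.length ≤ P.eval w.length by
    rw [List.length_reverse]; omega)
  simp only [mkStore_zero] at h10
  simp only [Polynomial.eval_add, Polynomial.eval_mul, Polynomial.eval_ofNat,
    Polynomial.eval_one, Polynomial.eval_comp]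
  omega

lemma exec_verifier {c : OracleProg} {f : List Bool → Bool}
    (hc : ∀ w : List Bool, ∃ τ : Store, c.Exec A (initStore w) τ ∧ τ 0 = [f w])
    {n : ℕ} (C : B2Circuit n) (q u : List Bool) :
    ∃ τ, (verifier c).Exec A (initStore (pairBits (pairBits q C.encode) u)) τ ∧
      τ 0 = [decide ((q.reverse ++ u).length = n) &&
        xor (C.evalList (q.reverse ++ u)) (f (q.reverse ++ u))] := by
  obtain ⟨a₀, a₁, a₂, a₄, a₅, h⟩ := exec_evalPrefix (A := A) C q u fun _ => []
  rw [← initStore_eq_mkStore] at h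
  set x := q.reverse ++ u
  set a₃ := if x.length = n then [C.evalList x] else [] with ha₃
  obtain ⟨ρ, ⟨t, hρ⟩, hρ0⟩ := hc x
  have h5 := exec_move_six_seven (A := A) a₀ a₁ a₂ a₃ a₄ a₅ x.reverse
  rw [List.reverse_reverse] at h5
  have h6 := hρ.shift a₀ a₁ a₂ a₃ a₄ a₅ []
  have h7 : ∃ τ, compareBits.Exec A (mkStore a₀ a₁ a₂ a₃ a₄ a₅ [] ρ) τ ∧
      τ 0 = [decide (x.length = n) && xor (C.evalList x) (f x)] := by
    by_cases hx : x.length = n <;> simp [compareBits, exec_move, ha₃, hx, hρ0]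
  obtain ⟨τ, h7, h8⟩ := h7
  refine ⟨τ, ?_, h8⟩
  simp only [verifier, exec_seq]
  exact ⟨_, h, _, ⟨_, h5⟩, _, ⟨_, h6⟩, h7⟩

end OracleProg

/-! ### Searching with an `NP` oracle for an input on which a circuit errs -/

namespace OracleProg

variable {A : Language Bool}

/-- On top of stack `2` there is a pair: put a bit in front of its first component so that the
oracle accepts, if possible. -/
def extend : OracleProg :=
  .seq (pushAll 2 [true, false]) (.query 2 .skip (onTop 2 .skip fun _ => onTop 2 .skip fun _ =>
    .seq (pushAll 2 [true, true]) (.query 2 .skip (onTop 2 .skip fun _ => onTop 2 .skip fun _ =>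
      .skip))))

lemma growsBy_extend : GrowsBy A extend 2 :=
  (growsBy_pushAll (by omega) [true, false]).seq (k₂ := 0) (.query (growsBy_skip _)
    (.onTop (by omega) (growsBy_skip _) fun _ => .onTop (by omega) (growsBy_skip _) fun _ =>
      (growsBy_pushAll (by omega) [true, true]).seq (k₂ := 0) (.query (growsBy_skip _)
        (.onTop (by omega) (growsBy_skip _) fun _ => .onTop (by omega) (growsBy_skip _) fun _ =>
          growsBy_skip _))))

/-- The search: find the bits of the input one after the other. -/
def search : OracleProg :=
  seqAll [move 0 1, copy 1 2 3 fun _ => [true, true, true], .push 2 false,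
    .loop 3 (onTop 3 .skip fun _ => onTop 3 .skip fun _ => onTop 3 .skip fun _ => extend),
    unpair 2 0]

lemma polyBounded_search : PolyBounded A search := by
  refine polyBounded_seqAll fun c hc => ?_
  simp only [List.mem_cons, List.not_mem_nil, or_false] at hc
  rcases hc with rfl | rfl | rfl | rfl | rfl
  · exact (growsBy_move (by omega) (by omega) (by omega)).polyBounded
  · exact polyBounded_copy (by omega) (by omega) (by omega) (by omega) (by omega) (by omega)
      (m := 3) fun _ => rfl
  · exact (growsBy_push (by omega) false).polyBounded
  -- The counter uses three bits per round: one drives the loop, and two pay for the two bits that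
  -- `extend` may add.
  · exact (GrowsBy.loop (by omega) fun _ => .onTop (by omega) (growsBy_skip _) fun _ =>
      .onTop (by omega) (growsBy_skip _) fun _ => growsBy_extend).polyBounded
  · exact (growsBy_unpair (by omega) (by omega)).polyBounded

/-- The reason for keeping the prefix reversed: extending it by a bit means pushing two bits on the
encoded pair. -/
lemma pairBits_cons (b : Bool) (q u : List Bool) :
    pairBits (b :: q) u = true :: b :: pairBits q u := rfl

/-- The invariant is that `q` can be completed. A nonempty completion begins with a bit that the
oracle accepts, so if both bits are rejected, `q` is already complete and surplus rounds do no harm.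
-/
lemma exec_extend {n : ℕ} {bad : List Bool → Prop} {e : List Bool}
    (hA : ∀ q, pairBits q e ∈ A ↔ ∃ u, (q.reverse ++ u).length = n ∧ bad (q.reverse ++ u))
    {q : List Bool} (hq : ∃ u, (q.reverse ++ u).length = n ∧ bad (q.reverse ++ u))
    (a₀ a₁ a₃ a₄ a₅ a₆ : List Bool) (ρ : Store) :
    ∃ q', (∃ u, (q'.reverse ++ u).length = n ∧ bad (q'.reverse ++ u)) ∧
      min n (q.length + 1) ≤ q'.length ∧
      Exec A extend (mkStore a₀ a₁ (pairBits q e) a₃ a₄ a₅ a₆ ρ)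
        (mkStore a₀ a₁ (pairBits q' e) a₃ a₄ a₅ a₆ ρ) := by
  simp only [extend, exec_seq, exec_pushAll, exists_eq_left, mkStore_two, update_mkStore_two,
    List.cons_append, List.nil_append, ← pairBits_cons, exec_query]
  by_cases h0 : pairBits (false :: q) e ∈ A
  · refine ⟨false :: q, (hA _).1 h0, by simp, ?_⟩
    simp [h0]
  by_cases h1 : pairBits (true :: q) e ∈ A
  · refine ⟨true :: q, (hA _).1 h1, by simp, ?_⟩
    refine Or.inr ⟨h0, ?_⟩
    simp [pairBits_cons false, ← pairBits_cons true, h1]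
  · refine ⟨q, hq, ?_, ?_⟩
    · obtain ⟨u, hu, hbad⟩ := hq
      cases u with
      | nil => simp at hu; omega
      | cons b u =>
        exfalso
        have : pairBits (b :: q) e ∈ A := (hA _).2 ⟨u, by simpa using hu, by simpa using hbad⟩
        cases b
        · exact h0 this
        · exact h1 this
    · refine Or.inr ⟨h0, ?_⟩
      simp [pairBits_cons false, ← pairBits_cons true, h1]

lemma exec_search_loop {n : ℕ} {bad : List Bool → Prop} {e : List Bool}
    (hA : ∀ q, pairBits q e ∈ A ↔ ∃ u, (q.reverse ++ u).length = n ∧ bad (q.reverse ++ u))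
    (k : ℕ) {q : List Bool} (hq : ∃ u, (q.reverse ++ u).length = n ∧ bad (q.reverse ++ u))
    (a₀ a₁ a₄ a₅ a₆ : List Bool) (ρ : Store) :
    ∃ q', (∃ u, (q'.reverse ++ u).length = n ∧ bad (q'.reverse ++ u)) ∧
      min n (q.length + k) ≤ q'.length ∧
      Exec A (.loop 3 (onTop 3 .skip fun _ => onTop 3 .skip fun _ => onTop 3 .skip fun _ => extend))
        (mkStore a₀ a₁ (pairBits q e) (List.replicate (3 * k) true) a₄ a₅ a₆ ρ)
        (mkStore a₀ a₁ (pairBits q' e) [] a₄ a₅ a₆ ρ) := by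
  induction k generalizing q with
  | zero =>
    refine ⟨q, hq, by simp, ?_⟩
    rw [exec_loop_nil (by simp)]
    simp
  | succ k ih =>
    obtain ⟨q₁, hq₁, hlen₁, h₁⟩ := exec_extend hA hq a₀ a₁ (List.replicate (3 * k) true) a₄ a₅ a₆ ρ
    obtain ⟨q₂, hq₂, hlen₂, h₂⟩ := ih hq₁
    refine ⟨q₂, hq₂, by omega, ?_⟩
    have hrep : List.replicate (3 * (k + 1)) true =
        true :: true :: true :: List.replicate (3 * k) true := rfl
    rw [hrep, exec_loop_ne_nil (by simp)]
    exact ⟨_, by simpa using h₁, h₂⟩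

lemma exec_search {n : ℕ} {bad : List Bool → Prop} {e : List Bool}
    (hA : ∀ q, pairBits q e ∈ A ↔ ∃ u, (q.reverse ++ u).length = n ∧ bad (q.reverse ++ u))
    (hn : n ≤ e.length) (hbad : ∃ x, x.length = n ∧ bad x) :
    ∃ x τ, x.length = n ∧ bad x ∧ Exec A search (initStore e) τ ∧ τ 0 = x := by
  -- The length of the encoding serves as the number of rounds: it is at least n, so the completion
  -- `u` that remains is empty.
  obtain ⟨q, ⟨u, hu, hqu⟩, hlen, h⟩ := exec_search_loop hA e.length (q := []) (by simpa using hbad)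
    [] [] [] [] [] fun _ => []
  have hu0 : u = [] := by
    rw [List.length_append, List.length_reverse] at hu
    exact List.length_eq_zero_iff.1 (by omega)
  subst hu0
  rw [List.append_nil] at hu hqu
  have hcopy := fun σ τ => exec_copy (A := A) (r := 1) (s := 2) (q := 3)
    (w := fun _ => [true, true, true]) (m := 3) (by omega) (by omega) (by omega) (fun _ => rfl)
    (σ := σ) (τ := τ)
  have hunpair := fun τ => exec_unpair (A := A) (r := 2) (s := 0) (q := q) (u := e)
    (σ := mkStore [] [] (pairBits q e) [] [] [] [] fun _ => []) (τ := τ) (by omega) (by omega)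
    (by omega) rfl rfl
  have hrep : ∀ l : List Bool, l.flatMap (fun _ => [true, true, true]) =
      List.replicate (3 * l.length) true := by
    intro l
    induction l with
    | nil => rfl
    | cons b l ih => rw [List.flatMap_cons, ih]; rfl
  refine ⟨q.reverse, mkStore q.reverse [] e [] [] [] [] fun _ => [], hu, hqu, ?_, rfl⟩
  rw [initStore_eq_mkStore]
  simp only [search, exec_seqAll_cons, exec_move (show (0 : ℕ) ≠ 1 by omega), exists_eq_left,
    hcopy, exec_push, mkStore_zero, mkStore_one, mkStore_two, mkStore_three, update_mkStore_zero,
    update_mkStore_one, update_mkStore_two, update_mkStore_three, List.append_nil,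
    List.reverse_reverse, hrep]
  exact ⟨_, h, _, (hunpair _).2 rfl, by simp⟩

end OracleProg

open OracleProg

lemma B2Circuit.evalList_ofFn {n : ℕ} (C : B2Circuit n) (x : Fin n → Bool) :
    C.evalList (List.ofFn x) = C.eval x := rfl

lemma B2Circuit.le_length_encode {n : ℕ} (C : B2Circuit n) : n ≤ C.encode.length := by
  simp only [B2Circuit.encode, unaryBits, List.length_append, List.length_replicate]
  omega

lemma length_le_length_pairBits (w u : List Bool) : w.length ≤ (pairBits w u).length ∧
    u.length ≤ (pairBits w u).length := by
  induction w with
  | nil => simp [pairBits]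
  | cons b w ih =>
    rw [pairBits_cons]
    simp only [List.length_cons]
    omega

/-- There is an `NP` language that knows which strings can be completed to inputs on which a given
circuit differs from `f`. -/
lemma InP.exists_inNP {f : List Bool → Bool} (hf : InP f) :
    ∃ A : Language Bool, InNP A ∧ ∀ (n : ℕ) (C : B2Circuit n) (q : List Bool),
      pairBits q C.encode ∈ A ↔ ∃ u, (q.reverse ++ u).length = n ∧
        C.evalList (q.reverse ++ u) ≠ f (q.reverse ++ u) := by
  obtain ⟨c, p, hc⟩ := hf
  obtain ⟨P, hP⟩ := exists_runs_verifier hc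
  -- The predicate `V` is whatever bit the verifier prints; its meaning on encoded circuits follows
  -- by uniqueness of the final store.
  choose T τ V hT hV hτ using hP
  have hVspec : ∀ (n : ℕ) (C : B2Circuit n) (q u : List Bool),
      V (pairBits (pairBits q C.encode) u) = true ↔ (q.reverse ++ u).length = n ∧
        C.evalList (q.reverse ++ u) ≠ f (q.reverse ++ u) := by
    intro n C q u
    obtain ⟨τ', h1, h2⟩ := exec_verifier (f := f) (fun w => by
      obtain ⟨t, τ, -, h, h'⟩ := hc w
      exact ⟨τ, ⟨t, h⟩, h'⟩) C q u
    obtain rfl := h1.unique ⟨_, hV _⟩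
    rw [hτ, List.cons.injEq] at h2
    rw [h2.1]
    simp
  -- Length `w.length` suffices for certificates: a completion has at most n bits, and the encoding
  -- of the circuit has at least n.
  refine ⟨{w | ∃ u : List Bool, u.length ≤ w.length ∧ V (pairBits w u) = true},
    ⟨V, Polynomial.X, ⟨verifier c, P, fun w => ⟨T w, τ w, hT w, hV w, hτ w⟩⟩, fun w => ?_⟩,
    fun n C q => ?_⟩
  · rw [Polynomial.eval_X]
    rfl
  · constructor
    · rintro ⟨u, -, hu⟩
      exact ⟨u, (hVspec n C q u).1 hu⟩
    · rintro ⟨u, hu⟩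
      refine ⟨u, ?_, (hVspec n C q u).2 hu⟩
      have h1 := hu.1
      have h2 := C.le_length_encode
      have h3 := (length_le_length_pairBits q C.encode).2
      rw [List.length_append] at h1
      omega

/-- Circuits that do not compute a function `f ∈ P` can be refuted in `P^NP`. -/
theorem InP.exists_refuter {f : List Bool → Bool} (hf : InP f) :
    ∃ R ∈ PNPAlgorithms, ∀ (n : ℕ) (C : B2Circuit n), (∃ x, C.eval x ≠ f (List.ofFn x)) →
      ∃ x : Fin n → Bool, R C.encode = List.ofFn x ∧ C.eval x ≠ f (List.ofFn x) := by
  obtain ⟨A, hA, hspec⟩ := hf.exists_inNP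
  obtain ⟨P, hP⟩ := polyBounded_search (A := A)
  choose T τ hrun hT _ _ using fun w => hP (initStore w)
  refine ⟨fun w => τ w 0, ⟨A, hA, search, P, fun w => ⟨T w, τ w, ?_, hrun w, rfl⟩⟩,
    fun n C hC => ?_⟩
  · have hw : Store.size (initStore w) = w.length := by
      simp [Store.size, Finset.sum_range_succ, initStore]
    rw [← hw]
    exact hT w
  · obtain ⟨x, hx⟩ := hC
    obtain ⟨y, τ', hy, hbad, h1, h2⟩ := exec_search (bad := fun x => C.evalList x ≠ f x)
      (hspec n C) C.le_length_encode ⟨List.ofFn x, by simp, hx⟩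
    obtain rfl := h1.unique ⟨_, hrun _⟩
    subst hy
    refine ⟨y.get, ?_, ?_⟩
    · rw [List.ofFn_get]
      exact h2
    · rw [← B2Circuit.evalList_ofFn, List.ofFn_get]
      exact hbad

theorem mainTheorem7 (f : List Bool → Bool) (d : ℕ → ℕ) (hf : InP f)
    (hd : (fun n : ℕ => (d n : ℝ)) =o[atTop] (fun n : ℕ => (n : ℝ)))
    (hdisp : ∀ n : ℕ, IsAffineDisperser (d n) (sliceF2 f n)) :
    ∃ s : ℕ → ℝ,
      (fun n : ℕ => 3 * (n : ℝ) - s n) =o[atTop] (fun n : ℕ => (n : ℝ)) ∧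
      HasConstructiveSeparation PNPAlgorithms f s := by
  obtain ⟨R, hR, hspec⟩ := hf.exists_refuter
  -- The loss 4d + 4 is the one from `IsAffineDisperser.exists_ne`, and it is o(n) because d is. The
  -- refuter then succeeds for every n.
  refine ⟨fun n => 3 * (n : ℝ) - (4 * (d n : ℝ) + 4), ?_, R, hR, .of_forall fun n C hC =>
    hspec n C ((hdisp n).exists_ne C ?_)⟩
  · have h4 : (fun _ : ℕ => (4 : ℝ)) =o[atTop] (fun n : ℕ => (n : ℝ)) :=
      isLittleO_const_left.2 (Or.inr (tendsto_norm_atTop_atTop.comp tendsto_natCast_atTop_atTop))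
    refine ((hd.const_mul_left 4).add h4).congr_left fun n => ?_
    ring
  · have h : (C.size : ℝ) + 4 * d n + 4 < 3 * n := by linarith
    exact_mod_cast h
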